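/- Let $\Delta$ be a smooth fan in $N_{\mathbb R}$, $N\cong\mathbb Z^n$ (a finite fan of strongly convex rational polyhedral cones, each generated by part of a $\mathbb Z$-basis of $N$), and let $X=X(\Delta)$ be the associated real toric variety, i.e. the space obtained by gluing the affine pieces $U_\sigma=\mathrm{Hom}_{sg}(\sigma^\vee\cap M,\mathbb R)$, $\sigma\in\Delta$, $M=\mathrm{Hom}(N,\mathbb Z)$, along the $U_{\sigma\cap\tau}$, where $\mathrm{Hom}_{sg}$ denotes the maps taking sums to products and $0$ to $1$. Assume that $X$ is connected. Let $v_1,\dots,v_d$ be the distinct primitive vectors along the edges (one-dimensional cones) of $\Delta$, numbered so that $v_1,\dots,v_n$ form a basis of $N\otimes_{\mathbb Z}\mathbb Z_2$, with dual basis $u_1,\dots,u_n$, and assume that $\{v_p,v_q\}$ spans a cone in $\Delta$ for all $1\le p,q\le n$. Then $\pi_1(X)$ is abelian if and only if one of the following holds (they are not mutually exclusive): (i) for every $1\le i,j\le d$, $\{v_i,v_j\}$ spans a cone in $\Delta$; (ii) for each $1\le j\le d$ there is at most one index $i$, $1\le i\le d$, such that $\{v_i,v_j\}$ does not span a cone in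 $\Delta$; and if $n+1\le j\le d$ and such an index $i=i_j$ exists, then $1\le i_j\le n$, $\langle u_{i_j},v_j\rangle\equiv 1 \bmod 2$, and $\langle u_{i_j},v_k\rangle\equiv 0\bmod 2$ for every $n+1\le k\le d$ with $k\ne j$. Moreover, in case (i), $\pi_1(X)\cong\mathbb Z_2^{\,d-n}$. -/

import Mathlib

/-!
# Real toric varieties of smooth fans

The lattice is `N = ℤⁿ`, its dual is `M = ℤⁿ`, the pairing `⟨u, v⟩` is the dot product, and
`N_ℝ = ℝⁿ`.
-/

namespace RealToric

/-- A lattice vector, regarded as a vector of `N_ℝ`. -/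
def toReal {n : ℕ} (v : Fin n → ℤ) : Fin n → ℝ := fun i => (v i : ℝ)

/-- The reduction of a lattice vector in `N ⊗ ℤ₂ = (ℤ/2)ⁿ`. -/
def mod2 {n : ℕ} (v : Fin n → ℤ) : Fin n → ZMod 2 := fun i => (v i : ZMod 2)

/-- The cone in `N_ℝ` spanned by a set of lattice vectors. -/
def cone {n : ℕ} (s : Set (Fin n → ℤ)) : PointedCone ℝ (Fin n → ℝ) :=
  PointedCone.hull ℝ (toReal '' s)

/-- A fan in `N_ℝ`: a finite nonempty collection of strongly convex rational polyhedral cones,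
closed under taking faces, in which two cones always meet in a common face. -/
structure Fan (n : ℕ) where
  /-- The cones of the fan. -/
  cones : Set (PointedCone ℝ (Fin n → ℝ))
  finite : cones.Finite
  nonempty : cones.Nonempty
  rational : ∀ σ ∈ cones, ∃ s : Finset (Fin n → ℤ), σ = cone (s : Set (Fin n → ℤ))
  salient : ∀ σ ∈ cones, (σ.toConvexCone).Salient
  face_mem : ∀ σ ∈ cones, ∀ τ : PointedCone ℝ (Fin n → ℝ), τ.IsFaceOf σ → τ ∈ cones
  inter_face : ∀ σ ∈ cones, ∀ τ ∈ cones, (σ ⊓ τ).IsFaceOf σ ∧ (σ ⊓ τ).IsFaceOf τ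

/-- A fan is smooth if each of its cones is spanned by a part of a `ℤ`-basis of the lattice. -/
def Fan.IsSmooth {n : ℕ} (Δ : Fan n) : Prop :=
  ∀ σ ∈ Δ.cones, ∃ (b : Module.Basis (Fin n) ℤ (Fin n → ℤ)) (I : Set (Fin n)), σ = cone (b '' I)

/-- The dimension of a cone. -/
noncomputable def dim {n : ℕ} (σ : PointedCone ℝ (Fin n → ℝ)) : ℕ :=
  Module.finrank ℝ (Submodule.span ℝ (σ : Set (Fin n → ℝ)))

/-- A lattice vector is primitive if it is not a proper multiple of a lattice vector. (The zero
vector is not primitive, since `0 = 2 • 0`.) -/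
def IsPrimitive {n : ℕ} (v : Fin n → ℤ) : Prop :=
  ∀ (k : ℤ) (w : Fin n → ℤ), v = k • w → IsUnit k

/-- `v 0, …, v (d - 1)` are the primitive vectors along the edges (one-dimensional cones) of the
fan, each edge being listed exactly once. -/
structure Fan.IsEdgeEnumeration {n d : ℕ} (Δ : Fan n) (v : Fin d → Fin n → ℤ) : Prop where
  primitive : ∀ j, IsPrimitive (v j)
  injective : Function.Injective v
  edges : ∀ ρ : PointedCone ℝ (Fin n → ℝ), (ρ ∈ Δ.cones ∧ dim ρ = 1) ↔ ∃ j, ρ = cone {v j}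

/-- The pair `{v, w}` spans a cone in the fan. -/
def Fan.SpansCone {n : ℕ} (Δ : Fan n) (v w : Fin n → ℤ) : Prop :=
  cone {v, w} ∈ Δ.cones

/-- The semigroup `S_σ = σ^∨ ∩ M`. -/
def dualSemigroup {n : ℕ} (σ : PointedCone ℝ (Fin n → ℝ)) : AddSubmonoid (Fin n → ℤ) where
  carrier := {u | ∀ x ∈ σ, 0 ≤ toReal u ⬝ᵥ x}
  zero_mem' := by
    intro x _
    simp [toReal, dotProduct]
  add_mem' := by
    intro a b ha hb x hx
    have h : toReal (a + b) ⬝ᵥ x = toReal a ⬝ᵥ x + toReal b ⬝ᵥ x := by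
      rw [← add_dotProduct]
      congr 1
      ext i
      simp [toReal]
    rw [h]
    exact add_nonneg (ha x hx) (hb x hx)

theorem dualSemigroup_anti {n : ℕ} {τ σ : PointedCone ℝ (Fin n → ℝ)} (h : τ ≤ σ) :
    dualSemigroup σ ≤ dualSemigroup τ :=
  fun _ hu x hx => hu x (h hx)

/-- The affine real toric variety `U_σ = Hom_sg(S_σ, ℝ)`: the maps `S_σ → ℝ` that send sums to
products and `0` to `1`. -/
def AffineChart {n : ℕ} (σ : PointedCone ℝ (Fin n → ℝ)) : Type :=
  Multiplicative (dualSemigroup σ) →* ℝ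

/-- `U_σ` carries the topology of pointwise convergence. -/
instance {n : ℕ} (σ : PointedCone ℝ (Fin n → ℝ)) : TopologicalSpace (AffineChart σ) :=
  TopologicalSpace.induced
    (fun (f : Multiplicative (dualSemigroup σ) →* ℝ) (u : Multiplicative (dualSemigroup σ)) => f u)
    inferInstance

/-- For `τ ⊆ σ`, the canonical map `U_τ → U_σ`, restriction from `S_τ` to `S_σ`. -/
def AffineChart.incl {n : ℕ} {τ σ : PointedCone ℝ (Fin n → ℝ)} (h : τ ≤ σ) (x : AffineChart τ) :
    AffineChart σ :=
  MonoidHom.comp x (AddMonoidHom.toMultiplicative (AddSubmonoid.inclusion (dualSemigroup_anti h)))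

/-- The gluing relation: a point of `U_σ` and a point of `U_τ` are identified if they come from
one and the same point of `U_{σ ∩ τ}`. -/
def Fan.Glue {n : ℕ} (Δ : Fan n) (p q : Σ σ : Δ.cones, AffineChart σ.1) : Prop :=
  ∃ z : AffineChart (p.1.1 ⊓ q.1.1),
    AffineChart.incl inf_le_left z = p.2 ∧ AffineChart.incl inf_le_right z = q.2

/-- The real toric variety `X(Δ)`: the affine pieces `U_σ`, `σ ∈ Δ`, glued along the `U_{σ ∩ τ}`,
with the quotient topology. -/
def Fan.X {n : ℕ} (Δ : Fan n) : Type := Quot Δ.Glue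

instance {n : ℕ} (Δ : Fan n) : TopologicalSpace Δ.X :=
  inferInstanceAs (TopologicalSpace (Quot Δ.Glue))

/-- Condition (i): any two edge vectors span a cone of the fan. -/
def AllPairsSpan {n d : ℕ} (Δ : Fan n) (v : Fin d → Fin n → ℤ) : Prop :=
  ∀ i j, Δ.SpansCone (v i) (v j)

/-- Condition (ii). The basis `b` of `N ⊗ ℤ₂` consists of the first `n` edge vectors, and
`b.coord p (mod2 w)` is `⟨u_p, w⟩ mod 2` for the dual basis `u`. For each edge vector `v j` there
is at most one edge vector `v i` that spans no cone together with it; if `j` is not among the first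
`n` indices and `i` exists, then `i` is the `p`-th of the first `n` indices for some `p`,
`⟨u_p, v j⟩` is odd, and `⟨u_p, v k⟩` is even for all `k ≠ j` that are not among the first `n`
indices. -/
def OddPartnerCondition {n d : ℕ} (Δ : Fan n) (v : Fin d → Fin n → ℤ) (hnd : n ≤ d)
    (b : Module.Basis (Fin n) (ZMod 2) (Fin n → ZMod 2)) : Prop :=
  ∀ j : Fin d,
    (∀ i i' : Fin d, ¬ Δ.SpansCone (v i) (v j) → ¬ Δ.SpansCone (v i') (v j) → i = i') ∧
    (n ≤ (j : ℕ) → ∀ i : Fin d, ¬ Δ.SpansCone (v i) (v j) →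
      ∃ p : Fin n, i = Fin.castLE hnd p ∧ b.coord p (mod2 (v j)) = 1 ∧
        ∀ k : Fin d, n ≤ (k : ℕ) → k ≠ j → b.coord p (mod2 (v k)) = 0)

end RealToric

/-!
# The fundamental group of a smooth real toric variety

The idea is to describe `X` as a space that is cut by mirrors into chambers. The nonnegative part of
`X` is a contractible manifold with corners, with one facet for each edge vector `v j`, and `X` is
covered by its `2ⁿ` translates under the elements of order two of the torus. These chambers are
labelled by `ε ∈ (ℤ/2)ⁿ`, and the facet `j` of the chamber `ε` is glued to that of the chamber
`ε + v j`. Two facets `i` and `j` intersect if and only if `v i` and `v j` span a cone. Let `W` be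
the right-angled Coxeter group with involutive generators `s j` such that `s i` and `s j` commute
whenever `v i` and `v j` span a cone. Then `π₁(X)` is the kernel of the homomorphism
`W → (ℤ/2)ⁿ` with `s j ↦ v j`.

This is proved for an abstract `ChamberAtlas`, which records the properties of the affine charts
that matter: the components of a chart are simply connected, and they correspond to the cosets of
the subgroup of labels spanned by the walls of the chart. The group `W` acts on the homotopy classes
of paths from the base point to interior points of chambers (`galleryAction`): the generator `s j`
appends a path across the wall `j`, and the relations hold because they can be checked inside a
single chart. The action is transitive (`exists_galleryAction`), because a subdivision of any path
subordinate to the charts writes it as a concatenation of paths across walls. It is free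
(`exists_monodromy`), because there is a covering of `X` with fibre `W` in which crossing the wall
`j` is multiplication by `s j`. So the stabilizer of a chamber, the kernel of `W → (ℤ/2)ⁿ`, is the
fundamental group (`exists_fundamentalGroup_hom`). The atlas of `X` itself is `Fan.chamberAtlas`;
a chart `U_σ` is identified with `{x ∈ ℝⁿ | x i ≠ 0 for i ∉ I}` if `σ` is spanned by the part `I` of
a lattice basis.

It remains to decide when the kernel is abelian (`comm_ker_iff`). If some generator does not commute
with two others, or if one of the parity conditions fails, homomorphisms from `W` to `S₄` or `S₃`
exhibit two elements of the kernel that do not commute. Conversely, under the partner condition `W`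
is a product of groups `ℤ/2` and infinite dihedral groups `⟨s p, s j⟩`, and the parity conditions
force the elements of the kernel to have even length in each dihedral factor, hence to be
translations there. If all pairs span cones, `W = (ℤ/2)ᵈ` and the kernel is `(ℤ/2)ᵈ⁻ⁿ`
(`ker_equiv`).
-/

/-! ### Right-angled Coxeter groups -/

namespace RealToric

section Coxeter

variable {ι : Type*} {C : ι → ι → Prop} {G : Type*} [Group G]

/-- The defining relations of the right-angled Coxeter group: every generator is an involution,
and the generators `i` and `j` commute whenever `C i j` holds. -/
def coxeterRels (C : ι → ι → Prop) : Set (FreeGroup ι) :=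
  {r | ∃ j, r = FreeGroup.of j * FreeGroup.of j} ∪
    {r | ∃ i j, C i j ∧ r = FreeGroup.of i * FreeGroup.of j *
      (FreeGroup.of i)⁻¹ * (FreeGroup.of j)⁻¹}

/-- The right-angled Coxeter group whose generators `i` and `j` commute whenever `C i j` holds. -/
abbrev Coxeter (C : ι → ι → Prop) : Type _ := PresentedGroup (coxeterRels C)

namespace Coxeter

/-- The generator of a right-angled Coxeter group with index `j`. -/
abbrev gen (C : ι → ι → Prop) (j : ι) : Coxeter C := PresentedGroup.of j

theorem gen_mul_gen (j : ι) : gen C j * gen C j = 1 :=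
  PresentedGroup.one_of_mem (rels := coxeterRels C) (Or.inl ⟨j, rfl⟩)

theorem gen_inv (j : ι) : (gen C j)⁻¹ = gen C j :=
  inv_eq_of_mul_eq_one_left (gen_mul_gen j)

theorem commute_gen {i j : ι} (h : C i j) : Commute (gen C i) (gen C j) := by
  have h1 : gen C i * gen C j * (gen C i)⁻¹ * (gen C j)⁻¹ = 1 :=
    PresentedGroup.one_of_mem (rels := coxeterRels C) (Or.inr ⟨i, j, h, rfl⟩)
  rw [mul_inv_eq_one, mul_inv_eq_iff_eq_mul] at h1
  exact h1

/-- The universal property of a right-angled Coxeter group. -/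
def lift (f : ι → G) (hf : ∀ j, f j * f j = 1) (hC : ∀ i j, C i j → Commute (f i) (f j)) :
    Coxeter C →* G :=
  PresentedGroup.toGroup (f := f) (rels := coxeterRels C) (by
    rintro r (⟨j, rfl⟩ | ⟨i, j, h, rfl⟩)
    · simpa using hf j
    · simp [(hC i j h).eq])

@[simp]
theorem lift_gen (f : ι → G) (hf : ∀ j, f j * f j = 1)
    (hC : ∀ i j, C i j → Commute (f i) (f j)) (j : ι) : lift f hf hC (gen C j) = f j :=
  PresentedGroup.toGroup.of _

theorem induction {P : Coxeter C → Prop} (one : P 1)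
    (mul : ∀ j w, P w → P (gen C j * w)) (w : Coxeter C) : P w := by
  have hw : w ∈ Subgroup.closure (Set.range (gen C)) := by
    rw [PresentedGroup.closure_range_of]; trivial
  induction hw using Subgroup.closure_induction_left with
  | one => exact one
  | mul_left x hx y _ ih => obtain ⟨j, rfl⟩ := hx; exact mul j y ih
  | inv_mul_cancel x hx y _ ih => obtain ⟨j, rfl⟩ := hx; rw [gen_inv]; exact mul j y ih

/-- The homomorphism from the additive group `ℤ/2` given by an involution. -/
def involutionHom (g : G) (hg : g * g = 1) : Multiplicative (ZMod 2) →* G :=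
  AddMonoidHom.toMultiplicativeLeft
    (ZMod.lift 2 ⟨zmultiplesHom (Additive G) (Additive.ofMul g), by
      have : (2 : ℤ) • Additive.ofMul g = 0 := by
        rw [two_zsmul]
        exact congrArg Additive.ofMul hg
      simpa using this⟩)

theorem involutionHom_one (g : G) (hg : g * g = 1) :
    involutionHom g hg (Multiplicative.ofAdd 1) = g := by
  have h : (1 : ZMod 2) = ((1 : ℤ) : ZMod 2) := by simp
  change Additive.toMul (ZMod.lift 2 _ (1 : ZMod 2)) = g
  rw [h, ZMod.lift_coe]
  simp

theorem commute_involutionHom {g g' : G} (hg : g * g = 1) (hg' : g' * g' = 1)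
    (h : Commute g g') (x y : Multiplicative (ZMod 2)) :
    Commute (involutionHom g hg x) (involutionHom g' hg' y) := by
  have key : ∀ (k : G) (hk : k * k = 1) (z : Multiplicative (ZMod 2)),
      involutionHom k hk z = 1 ∨ involutionHom k hk z = k := by
    intro k hk z
    have hz : z = 1 ∨ z = Multiplicative.ofAdd 1 := by revert z; decide
    rcases hz with rfl | rfl
    · exact Or.inl (map_one _)
    · exact Or.inr (involutionHom_one _ _)
  rcases key g hg x with hx | hx <;> rcases key g' hg' y with hy | hy <;> rw [hx, hy] <;>
    simp [h]

/-- The homomorphism from `(ℤ/2)^κ` given by a finite family of commuting involutions. -/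
def involutionsHom {κ : Type*} [Fintype κ] (g : κ → G) (hg : ∀ j, g j * g j = 1)
    (hcomm : ∀ i j, Commute (g i) (g j)) : (κ → Multiplicative (ZMod 2)) →* G :=
  MonoidHom.noncommPiCoprod (fun j => involutionHom (g j) (hg j))
    (fun i j _ x y => commute_involutionHom (hg i) (hg j) (hcomm i j) x y)

theorem involutionsHom_single {κ : Type*} [Fintype κ] [DecidableEq κ] (g : κ → G)
    (hg : ∀ j, g j * g j = 1) (hcomm : ∀ i j, Commute (g i) (g j)) (j : κ) :
    involutionsHom g hg hcomm (Pi.mulSingle j (Multiplicative.ofAdd 1)) = g j :=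
  (MonoidHom.noncommPiCoprod_mulSingle (fun j => involutionHom (g j) (hg j)) j _).trans
    (involutionHom_one _ _)

end Coxeter

end Coxeter

end RealToric

/-! ### Chamber atlases -/

namespace RealToric

open scoped unitInterval
open Set Topology

/-- A predicate on homotopy classes of paths that is closed under concatenation holds for all of
them as soon as it holds for the paths inside the members of an open cover. -/
theorem pathQuotient_induction {X Λ : Type*} [TopologicalSpace X] {O : Λ → Set X}
    (hO : ∀ a, IsOpen (O a)) (hcov : ∀ x, ∃ a, x ∈ O a)
    {P : ∀ x y : X, Path.Homotopic.Quotient x y → Prop}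
    (htrans : ∀ (x y z : X) (γ : Path.Homotopic.Quotient x y) (γ' : Path.Homotopic.Quotient y z),
      P x y γ → P y z γ' → P x z (γ.trans γ'))
    (hloc : ∀ a (x y : X) (β : Path x y), range β ⊆ O a → P x y (.mk β))
    (x y : X) (γ : Path.Homotopic.Quotient x y) : P x y γ := by
  obtain ⟨β, rfl⟩ := Path.Homotopic.Quotient.mk_surjective γ
  obtain ⟨t, ht0, hmono, ⟨N, hN⟩, hsub⟩ := exists_monotone_Icc_subset_open_cover_unitInterval
    (c := fun a => β ⁻¹' O a) (fun a => (hO a).preimage β.continuous)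
    (fun s _ => mem_iUnion.2 (hcov (β s)))
  have hstep : ∀ k, P _ _ (.mk (β.subpath (t k) (t (k + 1)))) := by
    intro k
    obtain ⟨a, ha⟩ := hsub k
    refine hloc a _ _ _ ?_
    rw [Path.range_subpath_of_le _ _ _ (hmono (Nat.le_succ k))]
    rintro _ ⟨s, hs, rfl⟩
    exact ha hs
  have hall : ∀ k, P _ _ (.mk (β.subpath (t 0) (t k))) := by
    intro k
    induction k with
    | zero =>
      obtain ⟨a, ha⟩ := hcov (β (t 0))
      refine hloc a _ _ _ ?_
      rw [Path.subpath_self, Path.refl_range]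
      simpa using ha
    | succ k ih =>
      have := htrans _ _ _ _ _ ih (hstep k)
      rw [← Path.Homotopic.Quotient.mk_trans] at this
      rwa [Path.Homotopic.Quotient.eq.2
        ⟨Path.Homotopy.subpathTransSubpath β (t 0) (t k) (t (k + 1))⟩] at this
  have key : ∀ s s' : I, s = 0 → s' = 1 → P _ _ (.mk (β.subpath s s')) → P x y (.mk β) := by
    rintro s s' rfl rfl h
    rw [Path.subpath_zero_one] at h
    have aux : ∀ (x' y' : X) (hx : x' = x) (hy : y' = y), P x' y' (.mk (β.cast hx hy)) →
        P x y (.mk β) := by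
      rintro x' y' rfl rfl h; exact h
    exact aux _ _ _ _ h
  exact key _ _ ht0 (hN N le_rfl) (hall N)

/-- A space with an open cover `O` which is stratified like the quotient by the reflections
`wall j` of a manifold with corners.

The group `V` is a label set for the chambers: `InChamber ε x` says that `x` lies in the closed
chamber with label `ε`, and `pt ε` is an interior point of that chamber. The chart `O a` meets
exactly the walls in `J a`; its connected components are simply connected, and two chambers meet
the same component if and only if their labels differ by a sum of `wall j`, `j ∈ J a`. The relation
`C i j` means that the walls `i` and `j` intersect. -/
structure ChamberAtlas (X Λ : Type*) [TopologicalSpace X] {ι V : Type*} [AddCommGroup V]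
    (wall : ι → V) (C : ι → ι → Prop) where
  /-- The charts. -/
  O : Λ → Set X
  /-- The walls that meet a chart. -/
  J : Λ → Set ι
  /-- The interior points of the chambers. -/
  pt : V → X
  /-- The closed chambers. -/
  InChamber : V → X → Prop
  /-- A chart that meets the wall `j` and is contained in all other such charts. -/
  chartOf : ι → Λ
  isOpen_chart : ∀ a, IsOpen (O a)
  exists_mem : ∀ x, ∃ a, x ∈ O a
  exists_inter : ∀ a b, ∃ c, O c = O a ∩ O b ∧ J c = J a ∩ J b
  wall_add_wall : ∀ j, wall j + wall j = 0
  pt_mem : ∀ a ε, pt ε ∈ O a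
  inChamber_pt : ∀ ε ε', InChamber ε' (pt ε) ↔ ε' = ε
  exists_inChamber : ∀ x, ∃ ε, InChamber ε x
  joined : ∀ a x ε, x ∈ O a → InChamber ε x → JoinedIn (O a) (pt ε) x
  joined_wall : ∀ a j ε, j ∈ J a → JoinedIn (O a) (pt ε) (pt (ε + wall j))
  homotopic : ∀ a x y (β β' : Path x y), range β ⊆ O a → range β' ⊆ O a → β.Homotopic β'
  eventually_sub_mem : ∀ a x, x ∈ O a → ∀ᶠ y in 𝓝 x, ∀ ε ε', InChamber ε x →
    InChamber ε' y → ε' - ε ∈ AddSubgroup.closure (wall '' J a)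
  exists_coord : ∀ a, ∃ l : V →+ (J a → ZMod 2), ∀ j k : J a,
    (k = j → l (wall j) k = 1) ∧ (k ≠ j → l (wall j) k = 0)
  mem_chartOf : ∀ j, j ∈ J (chartOf j)
  chartOf_subset : ∀ a j, j ∈ J a → O (chartOf j) ⊆ O a
  rel_of_mem : ∀ a i j, i ∈ J a → j ∈ J a → C i j
  exists_mem_of_rel : ∀ i j, C i j → ∃ a, i ∈ J a ∧ j ∈ J a

namespace ChamberAtlas

variable {X Λ : Type*} [TopologicalSpace X] {ι V : Type*} [AddCommGroup V]
  {wall : ι → V} {C : ι → ι → Prop} (A : ChamberAtlas X Λ wall C)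

/-- The label of a chosen closed chamber that contains `x`. -/
noncomputable def label (x : X) : V := (A.exists_inChamber x).choose

theorem inChamber_label (x : X) : A.InChamber (A.label x) x := (A.exists_inChamber x).choose_spec

@[simp]
theorem label_pt (ε : V) : A.label (A.pt ε) = ε :=
  (A.inChamber_pt ε _).1 (A.inChamber_label _)

theorem eventually_label_sub_mem {a : Λ} {x : X} (hx : x ∈ A.O a) :
    ∀ᶠ y in 𝓝 x, A.label y - A.label x ∈ AddSubgroup.closure (wall '' A.J a) := by
  filter_upwards [A.eventually_sub_mem a x hx] with y hy
  exact hy _ _ (A.inChamber_label x) (A.inChamber_label y)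

/-- Along a path in a chart, the label only changes by the walls of that chart. -/
theorem label_sub_mem_of_path {a : Λ} {x y : X} (β : Path x y) (hβ : range β ⊆ A.O a) :
    A.label y - A.label x ∈ AddSubgroup.closure (wall '' A.J a) := by
  have h : IsLocallyConstant (fun t : I =>
      (QuotientAddGroup.mk (A.label (β t)) : V ⧸ AddSubgroup.closure (wall '' A.J a))) := by
    rw [IsLocallyConstant.iff_eventually_eq]
    intro t
    filter_upwards [β.continuous.continuousAt.eventually
      (A.eventually_label_sub_mem (hβ (mem_range_self t)))] with s hs
    rw [QuotientAddGroup.eq, ← neg_mem_iff]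
    simpa [sub_eq_add_neg, add_comm] using hs
  have h01 := h.apply_eq_of_preconnectedSpace 0 1
  simp only [Path.source, Path.target] at h01
  rw [QuotientAddGroup.eq] at h01
  simpa [sub_eq_add_neg, add_comm] using h01

/-! ### The covering associated with a family of involutions -/

section Covering

variable {G : Type*} [Group G] [Finite ι] (s : ι → G) (hs : ∀ j, s j * s j = 1)
  (hsC : ∀ i j, C i j → Commute (s i) (s j))

include hs hsC in
/-- The mod 2 coordinates of a chart turn the commuting involutions `s j`, `j ∈ J a`, into a
homomorphism from the labels. -/
theorem exists_sheet (a : Λ) :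
    ∃ c : V → G, ∀ j ∈ A.J a, ∀ ε, c (ε + wall j) = s j * c ε := by
  classical
  obtain ⟨l, hl⟩ := A.exists_coord a
  have := Fintype.ofFinite ι
  let F := Coxeter.involutionsHom (fun j : A.J a => s j) (fun j => hs j)
    (fun i j => hsC i j (A.rel_of_mem a i j i.2 j.2))
  refine ⟨fun ε => F (fun j => Multiplicative.ofAdd (l ε j)), fun j hj ε => ?_⟩
  rw [← Coxeter.involutionsHom_single (fun j : A.J a => s j) (fun j => hs j)
    (fun i j => hsC i j (A.rel_of_mem a i j i.2 j.2)) ⟨j, hj⟩, ← map_mul]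
  refine congrArg F (funext fun k => ?_)
  rw [map_add, add_comm, Pi.add_apply, ofAdd_add, Pi.mul_apply]
  by_cases h : k = ⟨j, hj⟩
  · rw [(hl ⟨j, hj⟩ k).1 h, h, Pi.mulSingle_eq_same]
  · rw [(hl ⟨j, hj⟩ k).2 h, Pi.mulSingle_eq_of_ne h, ofAdd_zero]

/-- The sheet of the covering over the chart `O a` in which the chamber with label `ε` carries the
element `sheet ε` of `G`: crossing the wall `j` multiplies this element by `s j`. -/
noncomputable def sheet (a : Λ) : V → G := (A.exists_sheet s hs hsC a).choose

theorem sheet_add_wall {a : Λ} {j : ι} (hj : j ∈ A.J a) (ε : V) :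
    A.sheet s hs hsC a (ε + wall j) = s j * A.sheet s hs hsC a ε :=
  (A.exists_sheet s hs hsC a).choose_spec j hj ε

/-- The change between two charts does not depend on the chamber inside a component of their
intersection, since crossing a common wall multiplies both sheets by the same element. -/
theorem sheet_inv_mul_sheet {a b c : Λ} (hc : A.J c = A.J a ∩ A.J b) {δ : V}
    (hδ : δ ∈ AddSubgroup.closure (wall '' A.J c)) (ε : V) :
    (A.sheet s hs hsC b (ε + δ))⁻¹ * A.sheet s hs hsC a (ε + δ) =
      (A.sheet s hs hsC b ε)⁻¹ * A.sheet s hs hsC a ε := by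
  have hwall : ∀ j ∈ A.J c, ∀ ε : V,
      (A.sheet s hs hsC b (ε + wall j))⁻¹ * A.sheet s hs hsC a (ε + wall j) =
        (A.sheet s hs hsC b ε)⁻¹ * A.sheet s hs hsC a ε := by
    intro j hj ε
    rw [hc] at hj
    rw [A.sheet_add_wall s hs hsC hj.1, A.sheet_add_wall s hs hsC hj.2]
    group
  induction hδ using AddSubgroup.closure_induction_left generalizing ε with
  | zero => simp
  | add_left x hx y _ ih =>
    obtain ⟨j, hj, rfl⟩ := hx
    rw [← add_assoc, ih, hwall j hj]
  | neg_add_cancel x hx y _ ih =>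
    obtain ⟨j, hj, rfl⟩ := hx
    rw [neg_eq_of_add_eq_zero_left (A.wall_add_wall j), ← add_assoc, ih, hwall j hj]

/-- The covering with fibre `G` in which crossing the wall `j` is multiplication by `s j`. -/
noncomputable def core [TopologicalSpace G] [DiscreteTopology G] : FiberBundleCore Λ X G where
  baseSet := A.O
  isOpen_baseSet := A.isOpen_chart
  indexAt x := (A.exists_mem x).choose
  mem_baseSet_at x := (A.exists_mem x).choose_spec
  coordChange a b x g := (A.sheet s hs hsC b (A.label x))⁻¹ * A.sheet s hs hsC a (A.label x) * g
  coordChange_self a x _ g := by simp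
  continuousOn_coordChange a b := by
    obtain ⟨c, hO, hJ⟩ := A.exists_inter a b
    rintro ⟨x, g⟩ hx
    refine ContinuousAt.continuousWithinAt ?_
    have hxc : x ∈ A.O c := hO ▸ hx.1
    have hcont : ContinuousAt (fun p : X × G =>
        (A.sheet s hs hsC b (A.label x))⁻¹ * A.sheet s hs hsC a (A.label x) * p.2) (x, g) :=
      (continuous_of_discreteTopology (f := fun g' : G =>
        (A.sheet s hs hsC b (A.label x))⁻¹ * A.sheet s hs hsC a (A.label x) * g')).continuousAt.comp
        continuousAt_snd
    refine hcont.congr ?_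
    filter_upwards [continuousAt_fst.eventually (A.eventually_label_sub_mem hxc)] with p hp
    have := A.sheet_inv_mul_sheet s hs hsC hJ hp (A.label x)
    rw [add_sub_cancel] at this
    rw [this]
  coordChange_comp a b c x _ g := by group

variable [TopologicalSpace G] [DiscreteTopology G]

theorem isCoveringMap_core : IsCoveringMap (A.core s hs hsC).proj :=
  FiberBundle.isCoveringMap (F := G) (E := (A.core s hs hsC).Fiber)

/-- The element of `G` carried by a point of the covering. It is not continuous, since it jumps at
the walls, but it compares the sheets over different charts. -/
noncomputable def carried (e : (A.core s hs hsC).TotalSpace) : G :=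
  A.sheet s hs hsC ((A.core s hs hsC).indexAt e.1) (A.label e.1) * @id G e.2

theorem carried_eq (a : Λ) (e : (A.core s hs hsC).TotalSpace) :
    A.carried s hs hsC e =
      A.sheet s hs hsC a (A.label e.1) * ((A.core s hs hsC).localTriv a e).2 := by
  rw [FiberBundleCore.localTriv_apply]
  have h : ∀ p q r : G, p * r = q * (q⁻¹ * p * r) := fun p q r => by group
  exact h _ _ _

/-- The effect of a path in a chart on the carried element. -/
theorem carried_monodromy {a : Λ} {x y : X} (β : Path x y) (hβ : range β ⊆ A.O a)
    (e : (A.core s hs hsC).proj ⁻¹' {x}) :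
    A.carried s hs hsC ((A.isCoveringMap_core s hs hsC).monodromy (.mk β) e).1 =
      A.sheet s hs hsC a (A.label y) * (A.sheet s hs hsC a (A.label x))⁻¹ *
        A.carried s hs hsC e.1 := by
  set cov := A.isCoveringMap_core s hs hsC
  have h0 : β 0 = (A.core s hs hsC).proj e.1 := β.source.trans e.2.symm
  let Γ := cov.liftPath β e.1 h0
  have hproj : ∀ t, (A.core s hs hsC).proj (Γ t) = β t := fun t =>
    congrFun (cov.liftPath_lifts β e.1 h0) t
  have hcont : Continuous fun t : I => ((A.core s hs hsC).localTriv a (Γ t)).2 := by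
    rw [continuous_iff_continuousAt]
    intro t
    have hmem : Γ t ∈ ((A.core s hs hsC).localTriv a).source := by
      rw [FiberBundleCore.mem_localTriv_source]
      change (Γ t).1 ∈ A.O a
      rw [show (Γ t).1 = β t from hproj t]
      exact hβ (mem_range_self t)
    exact continuous_snd.continuousAt.comp
      ((((A.core s hs hsC).localTriv a).continuousAt hmem).comp Γ.continuous.continuousAt)
  have hconst := ((IsLocallyConstant.iff_continuous _).2 hcont).apply_eq_of_preconnectedSpace 1 0
  have h1 : (Γ 1).1 = y := (hproj 1).trans β.target
  have h2 : Γ 0 = e.1 := cov.liftPath_zero β e.1 h0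
  have hx : e.1.1 = x := e.2
  change A.carried s hs hsC (Γ 1) = _
  simp only [h2] at hconst
  rw [A.carried_eq s hs hsC a (Γ 1), A.carried_eq s hs hsC a e.1, hconst, h1, hx]
  group

end Covering

end ChamberAtlas

end RealToric

namespace RealToric

open scoped unitInterval
open Set Topology

/-! ### The fundamental group of a space with a chamber atlas -/

namespace ChamberAtlas

variable {X Λ : Type*} [TopologicalSpace X] {ι V : Type*} [AddCommGroup V]
  {wall : ι → V} {C : ι → ι → Prop} (A : ChamberAtlas X Λ wall C)

/-- A path from the interior point of the chamber `ε` to that of its neighbour across the wall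
`j`, inside the smallest chart that meets this wall. -/
noncomputable def cross (ε : V) (j : ι) : Path (A.pt ε) (A.pt (ε + wall j)) :=
  (A.joined_wall (A.chartOf j) j ε (A.mem_chartOf j)).somePath

theorem range_cross_subset {a : Λ} {j : ι} (hj : j ∈ A.J a) (ε : V) :
    range (A.cross ε j) ⊆ A.O a := by
  rintro _ ⟨t, rfl⟩
  exact A.chartOf_subset a j hj
    ((A.joined_wall (A.chartOf j) j ε (A.mem_chartOf j)).somePath_mem t)

/-- The homotopy classes of paths from the interior point of the chamber `0` to the interior
points of all chambers. -/
abbrev Gallery : Type _ := Σ ε : V, Path.Homotopic.Quotient (A.pt 0) (A.pt ε)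

/-- The constant gallery. -/
def baseGallery : A.Gallery := ⟨0, .refl _⟩

/-- The concatenation of a gallery with a path across the wall `j`. -/
noncomputable def step (j : ι) (h : A.Gallery) : A.Gallery :=
  ⟨h.1 + wall j, h.2.trans (.mk (A.cross h.1 j))⟩

/-- Galleries that differ only inside a chart are equal if they end in the same chamber. -/
theorem gallery_eq {a : Λ} {ε ε₁ ε₂ : V} (γ : Path.Homotopic.Quotient (A.pt 0) (A.pt ε))
    (β₁ : Path (A.pt ε) (A.pt ε₁)) (β₂ : Path (A.pt ε) (A.pt ε₂)) (h : ε₁ = ε₂)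
    (h₁ : range β₁ ⊆ A.O a) (h₂ : range β₂ ⊆ A.O a) :
    (⟨ε₁, γ.trans (.mk β₁)⟩ : A.Gallery) = ⟨ε₂, γ.trans (.mk β₂)⟩ := by
  subst h
  rw [Path.Homotopic.Quotient.eq.2 (A.homotopic a _ _ β₁ β₂ h₁ h₂)]

theorem step_step_eq {a : Λ} {i j : ι} (hi : i ∈ A.J a) (hj : j ∈ A.J a) (h : A.Gallery)
    {ε' : V} (β : Path (A.pt h.1) (A.pt ε')) (hβ : range β ⊆ A.O a)
    (hε : h.1 + wall i + wall j = ε') :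
    A.step j (A.step i h) = ⟨ε', h.2.trans (.mk β)⟩ := by
  simp only [step, Path.Homotopic.Quotient.trans_assoc]
  rw [← Path.Homotopic.Quotient.mk_trans]
  refine A.gallery_eq (a := a) _ _ _ hε ?_ hβ
  rw [Path.trans_range]
  exact union_subset (A.range_cross_subset hi _) (A.range_cross_subset hj _)

theorem step_involutive (j : ι) : Function.Involutive (A.step j) := by
  intro h
  have := A.step_step_eq (A.mem_chartOf j) (A.mem_chartOf j) h (Path.refl _)
    (by rw [Path.refl_range]; simpa using A.pt_mem _ _)
    (by rw [add_assoc, A.wall_add_wall, add_zero])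
  rw [this, Path.Homotopic.Quotient.mk_refl, Path.Homotopic.Quotient.trans_refl]

theorem step_comm {i j : ι} (hij : C i j) (h : A.Gallery) :
    A.step i (A.step j h) = A.step j (A.step i h) := by
  obtain ⟨a, hi, hj⟩ := A.exists_mem_of_rel i j hij
  rw [A.step_step_eq hj hi h ((A.cross h.1 i).trans (A.cross (h.1 + wall i) j)) ?_
    (add_right_comm _ _ _), Path.Homotopic.Quotient.mk_trans,
    ← Path.Homotopic.Quotient.trans_assoc]
  · rfl
  · rw [Path.trans_range]
    exact union_subset (A.range_cross_subset hi _) (A.range_cross_subset hj _)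

/-- The action of the Coxeter group on the galleries. -/
noncomputable def galleryAction : Coxeter C →* Equiv.Perm A.Gallery :=
  Coxeter.lift (fun j => Function.Involutive.toPerm (A.step j) (A.step_involutive j))
    (fun j => Equiv.ext (A.step_involutive j))
    (fun _ _ hij => Equiv.ext (A.step_comm hij))

@[simp]
theorem galleryAction_gen (j : ι) (h : A.Gallery) :
    A.galleryAction (Coxeter.gen C j) h = A.step j h := by
  exact DFunLike.congr_fun (Coxeter.lift_gen _ _ _ j) h

/-- The homomorphism that sends the generator `j` to the wall `j`. -/
noncomputable def wallHom : Coxeter C →* Multiplicative V :=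
  Coxeter.lift (fun j => Multiplicative.ofAdd (wall j))
    (fun j => congrArg Multiplicative.ofAdd (A.wall_add_wall j)) (fun _ _ _ => Commute.all _ _)

@[simp]
theorem wallHom_gen (j : ι) : A.wallHom (Coxeter.gen C j) = Multiplicative.ofAdd (wall j) :=
  Coxeter.lift_gen _ _ _ _

theorem galleryAction_fst (w : Coxeter C) (h : A.Gallery) :
    (A.galleryAction w h).1 = h.1 + (A.wallHom w).toAdd := by
  induction w using Coxeter.induction with
  | one => simp
  | mul j w ih =>
    rw [map_mul, Equiv.Perm.mul_apply, galleryAction_gen, map_mul, wallHom_gen]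
    simp [step, ih, add_comm, add_left_comm]

/-- The concatenation of a loop with a gallery. -/
noncomputable def prepend (α : Path.Homotopic.Quotient (A.pt 0) (A.pt 0)) (h : A.Gallery) : A.Gallery :=
  ⟨h.1, α.trans h.2⟩

theorem galleryAction_prepend (w : Coxeter C) (α : Path.Homotopic.Quotient (A.pt 0) (A.pt 0))
    (h : A.Gallery) : A.galleryAction w (A.prepend α h) = A.prepend α (A.galleryAction w h) := by
  induction w using Coxeter.induction with
  | one => simp
  | mul j w ih =>
    rw [map_mul, Equiv.Perm.mul_apply, Equiv.Perm.mul_apply, ih, galleryAction_gen,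
      galleryAction_gen]
    simp [step, prepend]

/-! The action on the galleries is transitive: every path crosses the walls one after another. -/

/-- The homotopy classes of paths that are concatenations of paths across walls. -/
inductive IsWord : ∀ {ε ε' : V}, Path.Homotopic.Quotient (A.pt ε) (A.pt ε') → Prop
  | refl (ε : V) : IsWord (.refl (A.pt ε))
  | cross {ε ε' : V} (γ : Path.Homotopic.Quotient (A.pt ε) (A.pt ε')) (j : ι) :
    IsWord γ → IsWord (γ.trans (.mk (A.cross ε' j)))

variable {A} in
theorem IsWord.trans {ε ε' ε'' : V} {γ : Path.Homotopic.Quotient (A.pt ε) (A.pt ε')}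
    {γ' : Path.Homotopic.Quotient (A.pt ε') (A.pt ε'')} (h : A.IsWord γ) (h' : A.IsWord γ') :
    A.IsWord (γ.trans γ') := by
  induction h' with
  | refl => rwa [Path.Homotopic.Quotient.trans_refl]
  | cross γ' j _ ih =>
    rw [← Path.Homotopic.Quotient.trans_assoc]
    exact .cross _ j ih

/-- Inside a chart, chambers whose labels differ by walls of this chart are connected by
concatenations of paths across walls. -/
theorem exists_isWord {a : Λ} {δ : V} (hδ : δ ∈ AddSubgroup.closure (wall '' A.J a)) (ε : V) :
    ∃ β : Path (A.pt ε) (A.pt (ε + δ)), range β ⊆ A.O a ∧ A.IsWord (.mk β) := by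
  have key : ∀ ε ε' : V, ε' = ε → ∃ β : Path (A.pt ε) (A.pt ε'),
      range β ⊆ A.O a ∧ A.IsWord (.mk β) := by
    rintro ε _ rfl
    refine ⟨Path.refl _, ?_, ?_⟩
    · rw [Path.refl_range]; simpa using A.pt_mem _ _
    · rw [Path.Homotopic.Quotient.mk_refl]; exact .refl _
  have hstep : ∀ (ε ε' ε'' : V) (j : ι), j ∈ A.J a → ε'' = ε' + wall j →
      (∃ β : Path (A.pt ε) (A.pt ε'), range β ⊆ A.O a ∧ A.IsWord (.mk β)) →
      ∃ β : Path (A.pt ε) (A.pt ε''), range β ⊆ A.O a ∧ A.IsWord (.mk β) := by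
    rintro ε ε' _ j hj rfl ⟨β, hβ, hw⟩
    refine ⟨β.trans (A.cross ε' j), ?_, ?_⟩
    · rw [Path.trans_range]
      exact union_subset hβ (A.range_cross_subset hj _)
    · rw [Path.Homotopic.Quotient.mk_trans]
      exact .cross _ j hw
  induction hδ using AddSubgroup.closure_induction_right with
  | zero => exact key _ _ (add_zero _)
  | add_right x _ y hy ih =>
    obtain ⟨j, hj, rfl⟩ := hy
    exact hstep _ _ _ j hj (add_assoc _ _ _).symm ih
  | add_neg_cancel x _ y hy ih =>
    obtain ⟨j, hj, rfl⟩ := hy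
    refine hstep _ _ _ j hj ?_ ih
    rw [neg_eq_of_add_eq_zero_left (A.wall_add_wall j), add_assoc]

/-- A path from the interior point of a chamber that contains `x` to `x`. -/
noncomputable def toPoint (x : X) : Path (A.pt (A.label x)) x :=
  (A.joined _ x _ (A.exists_mem x).choose_spec (A.inChamber_label x)).somePath

/-- In any chart that contains `x`, the path to `x` can be chosen inside this chart. -/
theorem exists_homotopic_toPoint {a : Λ} {x : X} (hx : x ∈ A.O a) :
    ∃ β : Path (A.pt (A.label x)) x, range β ⊆ A.O a ∧ β.Homotopic (A.toPoint x) := by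
  set b := (A.exists_mem x).choose
  have hb : x ∈ A.O b := (A.exists_mem x).choose_spec
  obtain ⟨c, hc, -⟩ := A.exists_inter a b
  have hJ := A.joined c x _ (hc ▸ ⟨hx, hb⟩) (A.inChamber_label x)
  have hrange : range hJ.somePath ⊆ A.O a ∩ A.O b := by
    rw [← hc]
    rintro _ ⟨t, rfl⟩
    exact hJ.somePath_mem t
  refine ⟨hJ.somePath, hrange.trans inter_subset_left,
    A.homotopic b _ _ _ _ (hrange.trans inter_subset_right) ?_⟩
  rintro _ ⟨t, rfl⟩
  exact (A.joined _ x _ (A.exists_mem x).choose_spec (A.inChamber_label x)).somePath_mem t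

/-- Up to the paths that connect its endpoints with interior points of chambers, every path is a
concatenation of paths across walls: by subdivision it suffices to treat a path inside a chart,
where all paths with the same endpoints are homotopic. -/
theorem isWord_of_path (x y : X) (γ : Path.Homotopic.Quotient x y) :
    A.IsWord (((Path.Homotopic.Quotient.mk (A.toPoint x)).trans γ).trans
      (.symm (.mk (A.toPoint y)))) := by
  refine pathQuotient_induction A.isOpen_chart A.exists_mem (P := fun x y γ =>
    A.IsWord (((Path.Homotopic.Quotient.mk (A.toPoint x)).trans γ).trans
      (.symm (.mk (A.toPoint y))))) ?_ ?_ x y γ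
  · intro x y z γ γ' h h'
    have := h.trans h'
    simp only [Path.Homotopic.Quotient.trans_assoc] at this
    rw [← Path.Homotopic.Quotient.trans_assoc (.symm _) (.mk _),
      Path.Homotopic.Quotient.symm_trans, Path.Homotopic.Quotient.refl_trans] at this
    simpa only [Path.Homotopic.Quotient.trans_assoc] using this
  · intro a x y β hβ
    obtain ⟨βx, hβx, hx⟩ := A.exists_homotopic_toPoint (hβ β.source_mem_range)
    obtain ⟨βy, hβy, hy⟩ := A.exists_homotopic_toPoint (hβ β.target_mem_range)
    obtain ⟨δ, hδ, hw⟩ := A.exists_isWord (A.label_sub_mem_of_path β hβ) (A.label x)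
    have haux : ∀ (ε' : V) (hε : A.label y = ε') (β' : Path (A.pt (A.label x)) (A.pt ε')),
        range β' ⊆ A.O a → A.IsWord (.mk β') →
        ∃ β'' : Path (A.pt (A.label x)) (A.pt (A.label y)), range β'' ⊆ A.O a ∧
          A.IsWord (.mk β'') := by
      rintro _ rfl β' h h'
      exact ⟨β', h, h'⟩
    obtain ⟨δ, hδ, hw⟩ := haux _ (add_sub_cancel _ _).symm δ hδ hw
    have h1 : ((βx.trans β).trans βy.symm).Homotopic δ := by
      refine A.homotopic a _ _ _ _ ?_ hδ
      rw [Path.trans_range, Path.trans_range, Path.symm_range]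
      exact union_subset (union_subset hβx hβ) hβy
    rw [← Path.Homotopic.Quotient.eq.2 hx, ← Path.Homotopic.Quotient.eq.2 hy,
      ← Path.Homotopic.Quotient.mk_trans, ← Path.Homotopic.Quotient.mk_symm,
      ← Path.Homotopic.Quotient.mk_trans, Path.Homotopic.Quotient.eq.2 h1]
    exact hw

/-- The path to the interior point of a chamber is constant up to homotopy; the cast accounts for
`label (pt ε) = ε`. -/
theorem mk_toPoint_pt (ε : V) : Path.Homotopic.Quotient.mk (A.toPoint (A.pt ε)) =
    (Path.Homotopic.Quotient.refl (A.pt ε)).cast (by rw [label_pt]) rfl := by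
  have haux : ∀ (ε' : V) (h : ε' = ε) (β : Path (A.pt ε') (A.pt ε)) (a : Λ),
      range β ⊆ A.O a → Path.Homotopic.Quotient.mk β =
        (Path.Homotopic.Quotient.refl (A.pt ε)).cast (by rw [h]) rfl := by
    rintro _ rfl β a hβ
    rw [Path.Homotopic.Quotient.cast_rfl_rfl, ← Path.Homotopic.Quotient.mk_refl]
    refine Path.Homotopic.Quotient.eq.2 (A.homotopic a _ _ _ _ hβ ?_)
    rw [Path.refl_range]
    simpa using A.pt_mem _ _
  obtain ⟨a, ha⟩ := A.exists_mem (A.pt ε)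
  obtain ⟨β, hβ, hβ'⟩ := A.exists_homotopic_toPoint ha
  rw [← Path.Homotopic.Quotient.eq.2 hβ']
  exact haux _ (A.label_pt ε) β a hβ

theorem isWord_all {ε ε' : V} (γ : Path.Homotopic.Quotient (A.pt ε) (A.pt ε')) :
    A.IsWord γ := by
  have haux : ∀ (δ δ' : V) (hδ : δ = ε) (hδ' : δ' = ε'),
      A.IsWord ((((Path.Homotopic.Quotient.refl (A.pt ε)).cast (by rw [hδ]) rfl :
        Path.Homotopic.Quotient (A.pt δ) (A.pt ε)).trans γ).trans
        (.symm ((Path.Homotopic.Quotient.refl (A.pt ε')).cast (by rw [hδ']) rfl :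
          Path.Homotopic.Quotient (A.pt δ') (A.pt ε')))) → A.IsWord γ := by
    rintro _ _ rfl rfl hh
    have hsymm : ∀ x : X, (Path.Homotopic.Quotient.refl x).symm = .refl x := fun x => by
      rw [← Path.Homotopic.Quotient.mk_refl, ← Path.Homotopic.Quotient.mk_symm, Path.refl_symm]
    simpa [hsymm] using hh
  have h := A.isWord_of_path _ _ γ
  rw [mk_toPoint_pt, mk_toPoint_pt] at h
  exact haux _ _ (A.label_pt ε) (A.label_pt ε') h

theorem exists_galleryAction (h : A.Gallery) :
    ∃ w, A.galleryAction w A.baseGallery = h := by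
  obtain ⟨ε, γ⟩ := h
  have : ∀ {ε₀ ε : V} (γ : Path.Homotopic.Quotient (A.pt ε₀) (A.pt ε)), A.IsWord γ →
      ∀ δ : Path.Homotopic.Quotient (A.pt 0) (A.pt ε₀),
      ∃ w, A.galleryAction w ⟨ε₀, δ⟩ = ⟨ε, δ.trans γ⟩ := by
    intro ε₀ ε γ h δ
    induction h with
    | refl => exact ⟨1, by simp⟩
    | cross γ j _ ih =>
      obtain ⟨w, hw⟩ := ih
      refine ⟨Coxeter.gen C j * w, ?_⟩
      rw [map_mul, Equiv.Perm.mul_apply, hw, galleryAction_gen]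
      simp [step]
  obtain ⟨w, hw⟩ := this γ (A.isWord_all γ) (.refl _)
  exact ⟨w, by rw [baseGallery, hw, Path.Homotopic.Quotient.refl_trans]⟩

/-! The action on the galleries is free, because it can be read off from the monodromy of the
covering whose fibre is the Coxeter group. -/

section Monodromy

variable [Finite ι]

/-- The end of the lift of a gallery to the covering with fibre the Coxeter group. -/
theorem exists_monodromy : ∃ m : A.Gallery → Coxeter C, m A.baseGallery = 1 ∧
    ∀ j h, m (A.step j h) = Coxeter.gen C j * m h := by
  let _ : TopologicalSpace (Coxeter C) := ⊥
  have : DiscreteTopology (Coxeter C) := ⟨rfl⟩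
  let s : ι → Coxeter C := Coxeter.gen C
  have hs : ∀ j, s j * s j = 1 := Coxeter.gen_mul_gen
  have hsC : ∀ i j, C i j → Commute (s i) (s j) := fun i j => Coxeter.commute_gen
  have cov := A.isCoveringMap_core s hs hsC
  let Z := A.core s hs hsC
  let g₀ : Coxeter C := (A.sheet s hs hsC (Z.indexAt (A.pt 0)) (A.label (A.pt 0)))⁻¹
  let e₀ : Z.proj ⁻¹' {A.pt 0} := ⟨⟨A.pt 0, g₀⟩, rfl⟩
  refine ⟨fun h => A.carried s hs hsC (cov.monodromy h.2 e₀).1, ?_, fun j h => ?_⟩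
  · simp only [baseGallery, cov.monodromy_refl]
    exact mul_inv_cancel _
  · simp only [step, cov.monodromy_trans_apply]
    rw [A.carried_monodromy s hs hsC (A.cross h.1 j) (A.range_cross_subset (A.mem_chartOf j) _),
      label_pt, label_pt, A.sheet_add_wall s hs hsC (A.mem_chartOf j)]
    simp [s]

/-- The fundamental group of a space with a chamber atlas is the kernel of the homomorphism
from the right-angled Coxeter group to the group of labels. -/
theorem exists_fundamentalGroup_hom :
    ∃ Φ : FundamentalGroup X (A.pt 0) →* Coxeter C,
      Function.Injective Φ ∧ Φ.range = A.wallHom.ker := by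
  obtain ⟨m, hm1, hm⟩ := A.exists_monodromy
  have hmw : ∀ w h, m (A.galleryAction w h) = w * m h := by
    intro w h
    induction w using Coxeter.induction with
    | one => simp
    | mul j w ih =>
      rw [map_mul, Equiv.Perm.mul_apply, galleryAction_gen, hm, ih, mul_assoc]
  have hact : ∀ h, A.galleryAction (m h) A.baseGallery = h := by
    intro h
    obtain ⟨w, rfl⟩ := A.exists_galleryAction h
    rw [hmw, hm1, mul_one]
  have hpre : ∀ α β : Path.Homotopic.Quotient (A.pt 0) (A.pt 0),
      m ⟨0, β.trans α⟩ = m ⟨0, α⟩ * m ⟨0, β⟩ := by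
    intro α β
    have h1 : (⟨0, β.trans α⟩ : A.Gallery) = A.prepend β ⟨0, α⟩ := rfl
    have h2 : A.prepend β A.baseGallery = ⟨0, β⟩ := by
      simp [prepend, baseGallery]
    rw [h1, ← hact ⟨0, α⟩, ← galleryAction_prepend, hmw, h2, hact]
  refine ⟨MonoidHom.mk' (fun α => m ⟨0, α⟩) (fun α β => hpre α β), fun α β hαβ => ?_, ?_⟩
  · have h : m ⟨0, α⟩ = m ⟨0, β⟩ := hαβ
    have h' := (hact ⟨0, α⟩).symm.trans ((congrArg (A.galleryAction · A.baseGallery) h).trans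
      (hact ⟨0, β⟩))
    exact eq_of_heq (Sigma.mk.inj h').2
  · ext w
    rw [MonoidHom.mem_ker]
    constructor
    · rintro ⟨α, rfl⟩
      have h := A.galleryAction_fst (m ⟨0, α⟩) A.baseGallery
      rw [hact] at h
      simpa [baseGallery] using h.symm
    · intro hw
      have h := A.galleryAction_fst w A.baseGallery
      rw [hw] at h
      have h0 : (A.galleryAction w A.baseGallery).1 = 0 := by simpa [baseGallery] using h
      obtain ⟨⟨ε, γ⟩, hg⟩ : ∃ g, g = A.galleryAction w A.baseGallery := ⟨_, rfl⟩
      rw [← hg] at h0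
      obtain rfl : ε = 0 := h0
      refine ⟨γ, ?_⟩
      change m ⟨0, γ⟩ = w
      rw [hg, hmw, hm1, mul_one]

end Monodromy

/-- If the walls generate the group of labels, the space is path connected. -/
theorem joined_pt_zero (hwall : AddSubgroup.closure (range wall) = ⊤) (x : X) :
    Joined (A.pt 0) x := by
  have h : ∀ δ ∈ AddSubgroup.closure (range wall), Joined (A.pt 0) (A.pt δ) := by
    intro δ hδ
    induction hδ using AddSubgroup.closure_induction_right with
    | zero => exact Joined.refl _
    | add_right x _ y hy ih =>
      obtain ⟨j, rfl⟩ := hy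
      exact ih.trans ⟨A.cross x j⟩
    | add_neg_cancel x _ y hy ih =>
      obtain ⟨j, rfl⟩ := hy
      rw [neg_eq_of_add_eq_zero_left (A.wall_add_wall j)]
      exact ih.trans ⟨A.cross x j⟩
  exact (h (A.label x) (hwall ▸ AddSubgroup.mem_top _)).trans ⟨A.toPoint x⟩

end ChamberAtlas

end RealToric

namespace RealToric

open Multiplicative (ofAdd)

/-! ### Homomorphisms from elementary abelian 2-groups -/

section Basis

variable {κ V G : Type*} [AddCommGroup V] [Module (ZMod 2) V] [Group G]
  (b : Module.Basis κ (ZMod 2) V)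

/-- A homomorphism vanishes at `v` if it vanishes at the basis vectors that occur in `v`. -/
theorem hom_ofAdd_eq_one (f : Multiplicative V →* G) {v : V}
    (h : ∀ q, b.coord q v ≠ 0 → f (ofAdd (b q)) = 1) : f (ofAdd v) = 1 := by
  have hv : v ∈ Submodule.span (ZMod 2) (b '' {q | f (ofAdd (b q)) = 1}) := by
    rw [b.mem_span_image]
    intro q hq
    exact h q (Finsupp.mem_support_iff.1 hq)
  clear h
  induction hv using Submodule.span_induction with
  | mem x hx => obtain ⟨q, hq, rfl⟩ := hx; exact hq
  | zero => exact map_one f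
  | add x y _ _ hx hy => rw [ofAdd_add, map_mul, hx, hy, one_mul]
  | smul c x _ hx =>
    have hc : c = 0 ∨ c = 1 := by revert c; decide
    rcases hc with rfl | rfl
    · rw [zero_smul]; exact map_one f
    · rwa [one_smul]

theorem hom_ofAdd_eq (f : Multiplicative V →* G) {v : V} {p : κ} (hp : b.coord p v = 1)
    (h : ∀ q, q ≠ p → b.coord q v ≠ 0 → f (ofAdd (b q)) = 1) :
    f (ofAdd v) = f (ofAdd (b p)) := by
  have h1 : f (ofAdd (v - b p)) = 1 := by
    refine hom_ofAdd_eq_one b f fun q hq => ?_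
    by_cases hqp : q = p
    · subst hqp
      simp only [Module.Basis.coord_apply] at hp
      simp [hp] at hq
    · refine h q hqp ?_
      simpa [Finsupp.single_eq_of_ne hqp] using hq
  rwa [ofAdd_sub, map_div, div_eq_one] at h1

theorem hom_ext_basis {f g : Multiplicative V →* G}
    (h : ∀ p, f (ofAdd (b p)) = g (ofAdd (b p))) : f = g := by
  have hv : ∀ v : V, f (ofAdd v) = g (ofAdd v) := by
    intro v
    have : v ∈ Submodule.span (ZMod 2) (Set.range b) := by rw [b.span_eq]; trivial
    induction this using Submodule.span_induction with
    | mem x hx => obtain ⟨q, rfl⟩ := hx; exact h q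
    | zero => exact (map_one f).trans (map_one g).symm
    | add x y _ _ hx hy => rw [ofAdd_add, map_mul, map_mul, hx, hy]
    | smul c x _ hx =>
      have hc : c = 0 ∨ c = 1 := by revert c; decide
      rcases hc with rfl | rfl
      · rw [zero_smul]; exact (map_one f).trans (map_one g).symm
      · rwa [one_smul]
  exact MonoidHom.ext hv

theorem exists_hom_basis [Finite κ] (g : κ → G) (hg : ∀ j, g j * g j = 1)
    (hcomm : ∀ i j, Commute (g i) (g j)) :
    ∃ f : Multiplicative V →* G, ∀ p, f (ofAdd (b p)) = g p := by
  classical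
  have := Fintype.ofFinite κ
  let φ : Multiplicative V →* (κ → Multiplicative (ZMod 2)) :=
    { toFun := fun v p => ofAdd (b.repr v.toAdd p)
      map_one' := by ext; simp
      map_mul' := fun x y => by ext; simp }
  refine ⟨(Coxeter.involutionsHom g hg hcomm).comp φ, fun p => ?_⟩
  rw [MonoidHom.comp_apply, ← Coxeter.involutionsHom_single g hg hcomm p]
  refine congrArg _ (funext fun q => ?_)
  by_cases h : q = p
  · subst h; simp [φ]
  · simp [φ, Pi.mulSingle_eq_of_ne h, Finsupp.single_eq_of_ne h]

end Basis

/-! ### The kernel of the homomorphism to the group of labels -/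

namespace Coxeter

variable {ι κ V : Type*} {C : ι → ι → Prop} [AddCommGroup V] [Module (ZMod 2) V]
  (b : Module.Basis κ (ZMod 2) V)

/-- The abstract form of `OddPartnerCondition`: each `j` has at most one partner `i`, that is, an
index with `¬ C i j`; if moreover `j` is not among the indices `e p` of the basis, then its partner
is one of them, and `j` is the only index outside the basis whose vector involves this partner. -/
def OddPartners (C : ι → ι → Prop) (wall : ι → V) (e : κ → ι) : Prop :=
  ∀ j : ι, (∀ i i', ¬ C i j → ¬ C i' j → i = i') ∧
    (j ∉ Set.range e → ∀ i, ¬ C i j → ∃ p, i = e p ∧ b.coord p (wall j) = 1 ∧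
      ∀ k, k ∉ Set.range e → k ≠ j → b.coord p (wall k) = 0)

variable {wall : ι → V} {e : κ → ι} {π : Coxeter C →* Multiplicative V}

theorem mul_self_mem_ker (π : Coxeter C →* Multiplicative V) (w : Coxeter C) :
    w * w ∈ π.ker := by
  rw [MonoidHom.mem_ker, map_mul]
  have h : ∀ x : V, x + x = 0 := fun x => by
    rw [← two_smul (ZMod 2) x, show (2 : ZMod 2) = 0 from rfl, zero_smul]
  exact h _

section

variable [Finite κ] (hπ : ∀ j, π (gen C j) = ofAdd (wall j)) (hb : ∀ p, b p = wall (e p))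
  (hbC : ∀ p q, C (e p) (e q))

include hπ hb hbC in
/-- The commuting generators of a basis split the homomorphism to the group of labels. -/
theorem exists_section : ∃ t : Multiplicative V →* Coxeter C,
    (∀ p, t (ofAdd (b p)) = gen C (e p)) ∧ ∀ x, π (t x) = x := by
  obtain ⟨t, ht⟩ := exists_hom_basis b (fun p => gen C (e p)) (fun p => gen_mul_gen _)
    (fun p q => commute_gen (hbC p q))
  refine ⟨t, ht, fun x => ?_⟩
  have : π.comp t = MonoidHom.id _ := hom_ext_basis b fun p => by
    rw [MonoidHom.comp_apply, ht, hπ, ← hb, MonoidHom.id_apply]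
  exact DFunLike.congr_fun this x

/-- Two generators that do not commute are sent to arbitrary involutions by a homomorphism that
kills all other generators. -/
theorem exists_lift_two (hsymm : ∀ i j, C i j → C j i) {i j : ι} (hij : ¬ C i j) (hne : i ≠ j)
    {G : Type*} [Group G] (x y : G) (hx : x * x = 1) (hy : y * y = 1) :
    ∃ f : Coxeter C →* G, f (gen C i) = x ∧ f (gen C j) = y ∧
      ∀ k, k ≠ i → k ≠ j → f (gen C k) = 1 := by
  classical
  refine ⟨lift (fun k => if k = i then x else if k = j then y else 1) ?_ ?_, ?_, ?_, ?_⟩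
  · intro k
    split_ifs <;> simp [hx, hy]
  · intro k l hkl
    split_ifs with h1 h2 h3 h4 h5 h6 <;> subst_vars <;>
      first
      | exact Commute.refl _
      | exact Commute.one_left _
      | exact Commute.one_right _
      | exact absurd hkl hij
      | exact absurd (hsymm _ _ hkl) hij
  · simp
  · simp [hne.symm]
  · intro k h1 h2
    simp [h1, h2]

/-- If the kernel is abelian, a generator fails to commute with at most one other generator: the
kernel contains all squares, and two of them are separated in the symmetric group `S₄`. -/
theorem eq_of_comm_ker (hsymm : ∀ i j, C i j → C j i) (hrefl : ∀ i, C i i)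
    (hcomm : ∀ x ∈ π.ker, ∀ y ∈ π.ker, x * y = y * x) {i i' j : ι} (hi : ¬ C i j)
    (hi' : ¬ C i' j) : i = i' := by
  classical
  by_contra hne
  have hij : i ≠ j := fun h => hi (h ▸ hrefl _)
  have hij' : i' ≠ j := fun h => hi' (h ▸ hrefl _)
  -- `(0 1)` and `(2 3)` commute, while their products with `(1 2)` are non-commuting 3-cycles.
  let f : Coxeter C →* Equiv.Perm (Fin 4) :=
    lift (fun k => if k = i then Equiv.swap 0 1 else if k = i' then Equiv.swap 2 3
      else if k = j then Equiv.swap 1 2 else 1) (by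
        intro k
        split_ifs <;> simp) (by
        have h0 : Commute (Equiv.swap 0 1 : Equiv.Perm (Fin 4)) (Equiv.swap 2 3) := by
          unfold Commute SemiconjBy; decide
        intro k l hkl
        split_ifs <;> subst_vars <;>
          first
          | exact Commute.refl _
          | exact Commute.one_left _
          | exact Commute.one_right _
          | exact h0
          | exact h0.symm
          | exact absurd hkl ‹_›
          | exact absurd (hsymm _ _ hkl) ‹_›)
  have f1 : f (gen C i) = Equiv.swap 0 1 := by simp [f]
  have f2 : f (gen C i') = Equiv.swap 2 3 := by simp [f, Ne.symm hne]
  have f3 : f (gen C j) = Equiv.swap 1 2 := by simp [f, hij.symm, hij'.symm]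
  have h := congrArg f (hcomm _ (mul_self_mem_ker π (gen C i * gen C j)) _
    (mul_self_mem_ker π (gen C i' * gen C j)))
  simp only [map_mul, f1, f2, f3] at h
  revert h
  decide

include hπ hb hbC in
/-- If the kernel is abelian, so is its image in `S₃` under the homomorphism that sends two
non-commuting generators to transpositions and kills the others; each violation of the condition
produces two elements of the kernel whose images do not commute. -/
theorem oddPartners_of_comm_ker (hsymm : ∀ i j, C i j → C j i) (hrefl : ∀ i, C i i)
    (hcomm : ∀ x ∈ π.ker, ∀ y ∈ π.ker, x * y = y * x) : OddPartners b C wall e := by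
  intro j
  refine ⟨fun i i' hi hi' => eq_of_comm_ker hsymm hrefl hcomm hi hi', fun hj i hi => ?_⟩
  obtain ⟨t, ht, hπt⟩ := exists_section b hπ hb hbC
  have hker : ∀ k, gen C k * t (ofAdd (wall k)) ∈ π.ker := by
    intro k
    rw [MonoidHom.mem_ker, map_mul, hπ, hπt, ← hπ, ← map_mul, gen_mul_gen, map_one]
  have hij : i ≠ j := fun h => hi (h ▸ hrefl _)
  obtain ⟨f, fi, fj, fk⟩ := exists_lift_two hsymm hi hij
    (Equiv.swap 0 1 : Equiv.Perm (Fin 3)) (Equiv.swap 1 2) (by simp) (by simp)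
  have hej : ∀ p, e p ≠ j := fun p h => hj ⟨p, h⟩
  have hcommf : ∀ x ∈ π.ker, ∀ y ∈ π.ker, f x * f y = f y * f x := fun x hx y hy => by
    rw [← map_mul, hcomm x hx y hy, map_mul]
  have hie : i ∈ Set.range e := by
    by_contra hie
    have hft : ∀ x, f (t x) = 1 := fun x => by
      have := hom_ofAdd_eq_one b (f.comp t) (v := x.toAdd) fun q _ => by
        rw [MonoidHom.comp_apply, ht]
        exact fk _ (fun h => hie ⟨q, h⟩) (hej q)
      exact this
    have h := hcommf _ (hker i) _ (hker j)
    simp only [map_mul, hft, fi, fj] at h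
    revert h
    decide
  obtain ⟨p, rfl⟩ := hie
  have hep : ∀ q, q ≠ p → f (gen C (e q)) = 1 := fun q hq => by
    refine fk _ (fun h => hq (b.injective ?_)) (hej q)
    rw [hb, hb, h]
  have ft0 : ∀ v, b.coord p v = 0 → f (t (ofAdd v)) = 1 := fun v hv =>
    hom_ofAdd_eq_one b (f.comp t) fun q hq => by
      rw [MonoidHom.comp_apply, ht]
      exact hep q (fun h => hq (h ▸ hv))
  have ft1 : ∀ v, b.coord p v = 1 → f (t (ofAdd v)) = Equiv.swap 0 1 := fun v hv => by
    have := hom_ofAdd_eq b (f.comp t) hv fun q hq _ => by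
      rw [MonoidHom.comp_apply, ht]
      exact hep q hq
    rwa [MonoidHom.comp_apply, MonoidHom.comp_apply, ht, fi] at this
  have h01 : ∀ c : ZMod 2, c = 0 ∨ c = 1 := by decide
  have hpj : b.coord p (wall j) = 1 := by
    refine (h01 _).resolve_left fun h0 => ?_
    have h := hcommf _ (hker j) _ (π.normal_ker.conj_mem _ (hker j) (gen C (e p)))
    simp only [map_mul, map_inv, ft0 _ h0, fi, fj] at h
    revert h
    decide
  refine ⟨p, rfl, hpj, fun k hk hkj => (h01 _).resolve_right fun h1 => ?_⟩
  have h := hcommf _ (hker j) _ (hker k)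
  simp only [map_mul, ft1 _ h1, ft1 _ hpj, fj, fk k (fun h => hk ⟨p, h.symm⟩) hkj] at h
  revert h
  decide

include hπ hb hbC in
/-- Under the partner condition, the kernel lies in the subgroup generated by the generators
without partner and the products of partners, which is abelian. Indeed there is a homomorphism `θ`
from the group of labels such that every `w` lies in the same coset of this subgroup as
`θ (π w)`, which is trivial if `w` lies in the kernel. -/
theorem comm_ker_of_oddPartners (hsymm : ∀ i j, C i j → C j i)
    (hodd : OddPartners b C wall e) : ∀ x ∈ π.ker, ∀ y ∈ π.ker, x * y = y * x := by
  classical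
  -- `T` consists of the indices outside the basis that have a partner.
  let T : Set ι := {j | j ∉ Set.range e ∧ ∃ i, ¬ C i j}
  have hT : ∀ j ∈ T, ∀ i ∈ T, C i j := by
    intro j hj i hi
    by_contra hij
    obtain ⟨p, rfl, -⟩ := (hodd j).2 hj.1 i hij
    exact hi.1 ⟨p, rfl⟩
  have hpart : ∀ p, ¬ (∀ i, C i (e p)) → ∃ j ∈ T, ¬ C j (e p) := by
    intro p hp
    obtain ⟨j, hj⟩ := not_forall.1 hp
    exact ⟨j, ⟨fun ⟨q, hq⟩ => hj (hq ▸ hbC q p), e p, fun h => hj (hsymm _ _ h)⟩, hj⟩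
  -- `θ` sends the basis vector of a partner of `j` to the generator `j`.
  let g : κ → Coxeter C := fun p =>
    if h : ∃ j ∈ T, ¬ C j (e p) then gen C h.choose else 1
  have hg : ∀ p, ∀ j ∈ T, ¬ C j (e p) → g p = gen C j := by
    intro p j hj hjp
    have h : ∃ j ∈ T, ¬ C j (e p) := ⟨j, hj, hjp⟩
    simp only [g, dif_pos h]
    rw [(hodd (e p)).1 _ _ h.choose_spec.2 hjp]
  have hg1 : ∀ p, (∀ j ∈ T, C j (e p)) → g p = 1 := by
    intro p hp
    exact dif_neg (fun ⟨j, hj, hjp⟩ => hjp (hp j hj))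
  have hgT : ∀ p, g p = 1 ∨ ∃ j ∈ T, g p = gen C j := by
    intro p
    by_cases h : ∃ j ∈ T, ¬ C j (e p)
    · obtain ⟨j, hj, hjp⟩ := h
      exact Or.inr ⟨j, hj, hg p j hj hjp⟩
    · refine Or.inl (hg1 p fun j hj => ?_)
      by_contra hjp
      exact h ⟨j, hj, hjp⟩
  obtain ⟨θ, hθ⟩ := exists_hom_basis b g
    (fun p => by rcases hgT p with h | ⟨j, -, h⟩ <;> rw [h] <;> simp [gen_mul_gen])
    (fun p q => by
      rcases hgT p with h | ⟨j, hj, h⟩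
      · rw [h]; exact Commute.one_left _
      rcases hgT q with h' | ⟨k, hk, h'⟩
      · rw [h']; exact Commute.one_right _
      · rw [h, h']; exact commute_gen (hT _ hk _ hj))
  have hθT : ∀ j ∈ T, θ (ofAdd (wall j)) = gen C j := by
    intro j hj
    obtain ⟨i, hij⟩ := hj.2
    obtain ⟨p, rfl, hp, -⟩ := (hodd j).2 hj.1 i hij
    rw [hom_ofAdd_eq b θ hp fun q hqp hq => ?_, hθ, hg p j hj (fun h => hij (hsymm _ _ h))]
    rw [hθ]
    refine hg1 q fun k hk => ?_
    by_contra hkq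
    obtain ⟨q', hq', h1, h2⟩ := (hodd k).2 hk.1 (e q) (fun h => hkq (hsymm _ _ h))
    obtain rfl : q = q' := b.injective (by rw [hb, hb, hq'])
    by_cases hkj : k = j
    · subst hkj
      exact hqp (b.injective (by
        rw [hb, hb, (hodd k).1 _ _ (fun h => hkq (hsymm _ _ h)) hij]))
    · exact hq (h2 j hj.1 (Ne.symm hkj))
  have hθ1 : ∀ j, j ∉ Set.range e → j ∉ T → θ (ofAdd (wall j)) = 1 := by
    intro j hj hjT
    refine hom_ofAdd_eq_one b θ fun q hq => ?_
    rw [hθ]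
    refine hg1 q fun k hk => ?_
    by_contra hkq
    obtain ⟨q', hq', -, h2⟩ := (hodd k).2 hk.1 (e q) (fun h => hkq (hsymm _ _ h))
    obtain rfl : q = q' := b.injective (by rw [hb, hb, hq'])
    exact hq (h2 j hj (fun h => hjT (h ▸ hk)))
  -- The generators of an abelian normal subgroup that contains the kernel.
  let B : Set (Coxeter C) := {w | (∃ i, (∀ k, C i k) ∧ w = gen C i) ∨
    ∃ i, ∃ j ∈ T, ¬ C i j ∧ w = gen C i * gen C j}
  have hB : ∀ x ∈ B, ∀ y ∈ B, x * y = y * x := by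
    have hunp : ∀ i, (∀ k, C i k) → ∀ w : Coxeter C, Commute (gen C i) w := by
      intro i hi w
      induction w using Coxeter.induction with
      | one => exact Commute.one_right _
      | mul j w ih => exact (commute_gen (hi j)).mul_right ih
    rintro x (⟨i, hi, rfl⟩ | ⟨i, j, hj, hij, rfl⟩) y hy
    · exact hunp i hi y
    · rcases hy with ⟨k, hk, rfl⟩ | ⟨k, l, hl, hkl, rfl⟩
      · exact (hunp k hk _).symm
      · by_cases hjl : j = l
        · subst hjl
          rw [(hodd j).1 _ _ hij hkl]
        · obtain ⟨p, rfl, -⟩ := (hodd j).2 hj.1 i hij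
          obtain ⟨q, rfl, -⟩ := (hodd l).2 hl.1 k hkl
          have h1 : C (e p) l := by
            by_contra h
            exact hjl ((hodd (e p)).1 _ _ (fun h' => hij (hsymm _ _ h'))
              (fun h' => h (hsymm _ _ h')))
          have h2 : C j (e q) := by
            by_contra h
            exact hjl ((hodd (e q)).1 _ _ h (fun h' => hkl (hsymm _ _ h')))
          exact ((commute_gen (hbC p q)).mul_right (commute_gen h1)).mul_left
            ((commute_gen h2).mul_right (commute_gen (hT l hl j hj)))
  have hconj : ∀ i, ∀ x ∈ Subgroup.closure B, gen C i * x * gen C i ∈ Subgroup.closure B := by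
    intro i x hx
    induction hx using Subgroup.closure_induction with
    | one => simp [gen_mul_gen]
    | mul x y _ _ hx hy =>
      have : gen C i * (x * y) * gen C i = gen C i * x * gen C i * (gen C i * y * gen C i) := by
        rw [show gen C i * x * gen C i * (gen C i * y * gen C i) =
          gen C i * x * (gen C i * gen C i) * y * gen C i by group, gen_mul_gen]
        group
      rw [this]
      exact mul_mem hx hy
    | inv x _ hx =>
      have : gen C i * x⁻¹ * gen C i = (gen C i * x * gen C i)⁻¹ := by
        simp [mul_inv_rev, gen_inv, mul_assoc]
      rw [this]
      exact inv_mem hx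
    | mem x hx =>
      rcases hx with ⟨k, hk, rfl⟩ | ⟨k, j, hj, hkj, rfl⟩
      · have : gen C i * gen C k * gen C i = gen C k := by
          rw [mul_assoc, (commute_gen (hk i)).eq, ← mul_assoc, gen_mul_gen, one_mul]
        rw [this]
        exact Subgroup.subset_closure (Or.inl ⟨k, hk, rfl⟩)
      · have hmem : gen C k * gen C j ∈ Subgroup.closure B :=
          Subgroup.subset_closure (Or.inr ⟨k, j, hj, hkj, rfl⟩)
        by_cases hik : i = k
        · subst hik
          have : gen C i * (gen C i * gen C j) * gen C i = (gen C i * gen C j)⁻¹ := by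
            rw [mul_inv_rev, gen_inv, gen_inv, ← mul_assoc, gen_mul_gen, one_mul]
          rw [this]
          exact inv_mem hmem
        · by_cases hij : i = j
          · subst hij
            have : gen C i * (gen C k * gen C i) * gen C i = (gen C k * gen C i)⁻¹ := by
              rw [mul_inv_rev, gen_inv, gen_inv, mul_assoc, mul_assoc, gen_mul_gen, mul_one]
            rw [this]
            exact inv_mem hmem
          · have h1 : C i j := by
              by_contra h
              exact hik ((hodd j).1 _ _ h hkj)
            have h2 : C i k := by
              by_contra h
              exact hij ((hodd k).1 _ _ h (fun h' => hkj (hsymm _ _ h')))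
            have : gen C i * (gen C k * gen C j) * gen C i = gen C k * gen C j := by
              rw [((commute_gen h2).mul_right (commute_gen h1)).eq, mul_assoc, gen_mul_gen,
                mul_one]
            rw [this]
            exact hmem
  have hθcomm : ∀ x y, Commute (θ x) (θ y) := fun x y => (Commute.all x y).map θ
  -- Every element lies in the same coset of the abelian subgroup as its image under `θ ∘ π`.
  have hw : ∀ w, w * (θ (π w))⁻¹ ∈ Subgroup.closure B := by
    intro w
    induction w using Coxeter.induction with
    | one => simp
    | mul i w ih =>
      have h1 : gen C i * (θ (π (gen C i)))⁻¹ ∈ Subgroup.closure B := by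
        rw [hπ]
        by_cases hi : i ∈ Set.range e
        · obtain ⟨p, rfl⟩ := hi
          rw [← hb, hθ]
          by_cases hp : ∃ j ∈ T, ¬ C j (e p)
          · obtain ⟨j, hj, hjp⟩ := hp
            rw [hg p j hj hjp, gen_inv]
            exact Subgroup.subset_closure
              (Or.inr ⟨e p, j, hj, fun h => hjp (hsymm _ _ h), rfl⟩)
          · have hp' : ∀ i, C i (e p) := by
              by_contra h
              exact hp (hpart p h)
            rw [hg1 p fun j _ => hp' j, inv_one, mul_one]
            exact Subgroup.subset_closure (Or.inl ⟨e p, fun k => hsymm _ _ (hp' k), rfl⟩)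
        · by_cases hiT : i ∈ T
          · rw [hθT i hiT, mul_inv_cancel]
            exact one_mem _
          · rw [hθ1 i hi hiT, inv_one, mul_one]
            refine Subgroup.subset_closure (Or.inl ⟨i, fun k => ?_, rfl⟩)
            by_contra h
            exact hiT ⟨hi, k, fun h' => h (hsymm _ _ h')⟩
      have h2 : gen C i * w * (θ (π (gen C i * w)))⁻¹ =
          gen C i * (w * (θ (π w))⁻¹) * gen C i * (gen C i * (θ (π (gen C i)))⁻¹) := by
        rw [map_mul, map_mul, (hθcomm _ _).eq, mul_inv_rev,
          ((hθcomm _ _).inv_inv).eq]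
        rw [show gen C i * (w * (θ (π w))⁻¹) * gen C i * (gen C i * (θ (π (gen C i)))⁻¹) =
          gen C i * w * (θ (π w))⁻¹ * (gen C i * gen C i) * (θ (π (gen C i)))⁻¹ by group,
          gen_mul_gen]
        group
      rw [h2]
      exact mul_mem (hconj i _ ih) h1
  have hmem : ∀ w ∈ π.ker, w ∈ Subgroup.closure B := by
    intro w hwk
    have := hw w
    rwa [MonoidHom.mem_ker.1 hwk, map_one, inv_one, mul_one] at this
  intro x hx y hy
  have := Subgroup.isMulCommutative_closure hB
  exact congrArg Subtype.val (mul_comm' (⟨x, hmem x hx⟩ : Subgroup.closure B) ⟨y, hmem y hy⟩)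

theorem comm_of_forall (hC : ∀ i j, C i j) (x y : Coxeter C) : x * y = y * x := by
  have h : ∀ i (w : Coxeter C), Commute (gen C i) w := by
    intro i w
    induction w using Coxeter.induction with
    | one => exact Commute.one_right _
    | mul j w ih => exact (commute_gen (hC i j)).mul_right ih
  change Commute x y
  induction x using Coxeter.induction with
  | one => exact Commute.one_left _
  | mul j w ih => exact (h j y).mul_left ih

include hπ hb hbC in
theorem comm_ker_iff (hsymm : ∀ i j, C i j → C j i) (hrefl : ∀ i, C i i) :
    (∀ x ∈ π.ker, ∀ y ∈ π.ker, x * y = y * x) ↔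
      (∀ i j, C i j) ∨ OddPartners b C wall e :=
  ⟨fun h => Or.inr (oddPartners_of_comm_ker b hπ hb hbC hsymm hrefl h), fun h => h.elim
    (fun h x _ y _ => comm_of_forall h x y)
    (fun h => comm_ker_of_oddPartners b hπ hb hbC hsymm h)⟩

include hπ hb in
/-- If all generators commute, the kernel is elementary abelian, with one generator for each index
outside the basis. -/
theorem ker_equiv [Finite ι] (hC : ∀ i j, C i j) :
    Nonempty (π.ker ≃* Multiplicative ({k // k ∉ Set.range e} → ZMod 2)) := by
  classical
  have := Fintype.ofFinite ι
  let b' := Pi.basisFun (ZMod 2) {k // k ∉ Set.range e}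
  have hinv : ∀ x : Coxeter C, x * x = 1 := by
    intro x
    induction x using Coxeter.induction with
    | one => simp
    | mul j w ih =>
      rw [show gen C j * w * (gen C j * w) = gen C j * (w * gen C j) * w by group,
        comm_of_forall hC w, show gen C j * (gen C j * w) * w = gen C j * gen C j * (w * w) by
          group, ih, gen_mul_gen, one_mul]
  obtain ⟨t, ht, hπt⟩ := exists_section b hπ hb (fun p q => hC (e p) (e q))
  -- The elements `gen k * t (wall k)` for `k` outside the basis form a basis of the kernel.
  obtain ⟨u, hu⟩ := exists_hom_basis b' (fun k => gen C k.1 * t (ofAdd (wall k)))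
    (fun k => hinv _) (fun k l => comm_of_forall hC _ _)
  let χ : Coxeter C →* Multiplicative ({k // k ∉ Set.range e} → ZMod 2) :=
    lift (fun k => if h : k ∉ Set.range e then ofAdd (b' ⟨k, h⟩) else 1)
      (fun k => by
        have h2 : ∀ x : {k // k ∉ Set.range e} → ZMod 2, x + x = 0 := fun x => by
          funext l
          exact CharTwo.add_self_eq_zero (x l)
        exact h2 _)
      (fun _ _ _ => Commute.all _ _)
  have hχ : ∀ k : {k // k ∉ Set.range e}, χ (gen C k.1) = ofAdd (b' k) := fun k =>
    (lift_gen _ _ _ _).trans (dif_pos k.2)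
  have hχe : ∀ p, χ (gen C (e p)) = 1 := fun p =>
    (lift_gen _ _ _ _).trans (dif_neg (not_not.2 ⟨p, rfl⟩))
  have hχt : ∀ x, χ (t x) = 1 := fun x =>
    DFunLike.congr_fun (hom_ext_basis b (f := χ.comp t) (g := 1) fun p => by simp [ht, hχe]) x
  have hχu : ∀ y, χ (u y) = y := fun y =>
    DFunLike.congr_fun (hom_ext_basis b' (f := χ.comp u) (g := MonoidHom.id _) fun k => by
      simp [hu, hχ, hχt]) y
  have hπu : ∀ y, π (u y) = 1 := fun y =>
    DFunLike.congr_fun (hom_ext_basis b' (f := π.comp u) (g := 1) fun k => by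
      rw [MonoidHom.comp_apply, hu, map_mul, hπ, hπt, ← hπ, ← map_mul, gen_mul_gen, map_one]
      rfl) y
  have hw : ∀ w, w = t (π w) * u (χ w) := by
    intro w
    induction w using Coxeter.induction with
    | one => simp
    | mul i w ih =>
      have hi : gen C i = t (π (gen C i)) * u (χ (gen C i)) := by
        by_cases h : i ∈ Set.range e
        · obtain ⟨p, rfl⟩ := h
          rw [hχe, map_one, mul_one, hπ, ← hb, ht]
        · rw [hχ ⟨i, h⟩, hu, hπ, comm_of_forall hC (gen C i), ← mul_assoc, hinv, one_mul]
      rw [map_mul, map_mul, map_mul, map_mul]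
      calc gen C i * w = t (π (gen C i)) * u (χ (gen C i)) * (t (π w) * u (χ w)) := by
            rw [← hi, ← ih]
        _ = t (π (gen C i)) * (u (χ (gen C i)) * t (π w)) * u (χ w) := by group
        _ = _ := by rw [comm_of_forall hC (u _)]; group
  refine ⟨MulEquiv.ofBijective (χ.comp π.ker.subtype) ⟨?_, fun y => ⟨⟨u y, hπu y⟩, hχu y⟩⟩⟩
  rw [injective_iff_map_eq_one]
  rintro ⟨w, hwk⟩ h
  have h1 : χ w = 1 := h
  have h2 := hw w
  rw [MonoidHom.mem_ker.1 hwk, h1, map_one, map_one, mul_one] at h2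
  exact Subtype.ext h2

end

end Coxeter

end RealToric

/-! ### Smooth cones -/

namespace RealToric

section Cones

variable {n : ℕ}

theorem toReal_dotProduct (u w : Fin n → ℤ) : toReal u ⬝ᵥ toReal w = ((u ⬝ᵥ w : ℤ) : ℝ) := by
  simp [toReal, dotProduct]

theorem toReal_mem_cone {s : Set (Fin n → ℤ)} {w : Fin n → ℤ} (hw : w ∈ s) :
    toReal w ∈ cone s :=
  Submodule.subset_span ⟨w, hw, rfl⟩

theorem cone_le_iff {s : Set (Fin n → ℤ)} {σ : PointedCone ℝ (Fin n → ℝ)} :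
    cone s ≤ σ ↔ ∀ w ∈ s, toReal w ∈ σ := by
  unfold cone PointedCone.hull
  rw [Submodule.span_le]
  exact Set.image_subset_iff

theorem mem_cone_singleton {w : Fin n → ℤ} {x : Fin n → ℝ} :
    x ∈ cone {w} ↔ ∃ c : ℝ, 0 ≤ c ∧ x = c • toReal w := by
  unfold cone PointedCone.hull
  rw [Set.image_singleton, Submodule.mem_span_singleton]
  constructor
  · rintro ⟨c, rfl⟩
    exact ⟨c.1, c.2, rfl⟩
  · rintro ⟨c, hc, rfl⟩
    exact ⟨⟨c, hc⟩, rfl⟩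

theorem mem_dualSemigroup_cone {s : Set (Fin n → ℤ)} {u : Fin n → ℤ} :
    u ∈ dualSemigroup (cone s) ↔ ∀ w ∈ s, 0 ≤ u ⬝ᵥ w := by
  constructor
  · intro h w hw
    have := h _ (toReal_mem_cone hw)
    rw [toReal_dotProduct] at this
    exact_mod_cast this
  · intro h x hx
    unfold cone PointedCone.hull at hx
    induction hx using Submodule.span_induction with
    | mem x hx =>
      obtain ⟨w, hw, rfl⟩ := hx
      rw [toReal_dotProduct]
      exact_mod_cast h w hw
    | zero => simp
    | add x y _ _ hx hy => rw [dotProduct_add]; exact add_nonneg hx hy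
    | smul c x _ hx =>
      rw [show c • x = (c : ℝ) • x from rfl, dotProduct_smul, smul_eq_mul]
      exact mul_nonneg c.2 hx

variable (b : Module.Basis (Fin n) ℤ (Fin n → ℤ))

/-- The basis of the dual lattice that is dual to a basis of the lattice. -/
noncomputable def dualVec (i : Fin n) : Fin n → ℤ := fun k => b.coord i (fun l => if k = l then 1 else 0)

theorem dualVec_dotProduct (i : Fin n) (w : Fin n → ℤ) : dualVec b i ⬝ᵥ w = b.coord i w := by
  rw [LinearMap.pi_apply_eq_sum_univ (b.coord i) w]
  simp [dotProduct, dualVec, mul_comm]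

theorem dualVec_dotProduct_basis (i k : Fin n) :
    dualVec b i ⬝ᵥ b k = if k = i then 1 else 0 := by
  rw [dualVec_dotProduct, Module.Basis.coord_apply, Module.Basis.repr_self,
    Finsupp.single_apply]

theorem eq_sum_dualVec (u : Fin n → ℤ) : u = ∑ i, (u ⬝ᵥ b i) • dualVec b i := by
  refine dotProduct_eq _ _ fun w => ?_
  rw [sum_dotProduct]
  conv_lhs => rw [← b.sum_repr w]
  rw [dotProduct_sum]
  refine Finset.sum_congr rfl fun i _ => ?_
  rw [dotProduct_smul, smul_dotProduct, dualVec_dotProduct, Module.Basis.coord_apply,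
    smul_eq_mul, smul_eq_mul, mul_comm]

theorem eq_sum_toReal (x : Fin n → ℝ) :
    x = ∑ i, (toReal (dualVec b i) ⬝ᵥ x) • toReal (b i) := by
  have h : ∀ k l : Fin n, ∑ i, (dualVec b i k : ℝ) * (b i l : ℝ) = if k = l then 1 else 0 := by
    intro k l
    have h1 := congrFun (b.sum_repr (fun l => if k = l then 1 else 0)) l
    simp only [Finset.sum_apply, Pi.smul_apply, smul_eq_mul] at h1
    have h2 := congrArg (Int.cast : ℤ → ℝ) h1
    push_cast at h2
    exact h2
  funext l
  simp only [Finset.sum_apply, Pi.smul_apply, smul_eq_mul, dotProduct, toReal, Finset.sum_mul]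
  rw [Finset.sum_comm]
  have h3 : ∀ k, ∑ i, (dualVec b i k : ℝ) * x k * (b i l : ℝ) = if k = l then x k else 0 := by
    intro k
    have : ∀ i, (dualVec b i k : ℝ) * x k * (b i l : ℝ) =
        ((dualVec b i k : ℝ) * (b i l : ℝ)) * x k := fun i => by ring
    simp_rw [this]
    rw [← Finset.sum_mul, h]
    split_ifs <;> simp
  simp_rw [h3]
  simp

theorem mem_cone_basis {I : Set (Fin n)} {x : Fin n → ℝ} :
    x ∈ cone (b '' I) ↔ ∀ i, (i ∈ I → 0 ≤ toReal (dualVec b i) ⬝ᵥ x) ∧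
      (i ∉ I → toReal (dualVec b i) ⬝ᵥ x = 0) := by
  constructor
  · intro hx i
    constructor
    · intro _
      refine (mem_dualSemigroup_cone (s := b '' I)).2 ?_ x hx
      rintro _ ⟨k, -, rfl⟩
      rw [dualVec_dotProduct_basis]
      split_ifs <;> simp
    · intro hi
      have h1 := (mem_dualSemigroup_cone (s := b '' I) (u := dualVec b i)).2 (by
        rintro _ ⟨k, -, rfl⟩
        rw [dualVec_dotProduct_basis]
        split_ifs <;> simp) x hx
      have h2 := (mem_dualSemigroup_cone (s := b '' I) (u := -dualVec b i)).2 (by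
        rintro _ ⟨k, hk, rfl⟩
        rw [neg_dotProduct, dualVec_dotProduct_basis,
          if_neg (fun h : k = i => hi (h ▸ hk)), neg_zero]) x hx
      have h3 : toReal (-dualVec b i) = -toReal (dualVec b i) := by ext; simp [toReal]
      rw [h3, neg_dotProduct] at h2
      linarith
  · intro h
    rw [eq_sum_toReal b x]
    refine Submodule.sum_mem _ fun i _ => ?_
    by_cases hi : i ∈ I
    · exact PointedCone.smul_mem _ ((h i).1 hi) (toReal_mem_cone ⟨i, hi, rfl⟩)
    · rw [(h i).2 hi, zero_smul]
      exact Submodule.zero_mem _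

theorem cone_basis_inf (I I' : Set (Fin n)) :
    cone (b '' I) ⊓ cone (b '' I') = cone (b '' (I ∩ I')) := by
  ext x
  rw [Submodule.mem_inf, mem_cone_basis, mem_cone_basis, mem_cone_basis]
  constructor
  · rintro ⟨h, h'⟩ i
    refine ⟨fun hi => (h i).1 hi.1, fun hi => ?_⟩
    by_cases h1 : i ∈ I
    · exact (h' i).2 fun h2 => hi ⟨h1, h2⟩
    · exact (h i).2 h1
  · intro h
    have key : ∀ i, 0 ≤ toReal (dualVec b i) ⬝ᵥ x := fun i => by
      by_cases hi : i ∈ I ∩ I'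
      · exact (h i).1 hi
      · exact ((h i).2 hi).ge
    exact ⟨fun i => ⟨fun _ => key i, fun hi => (h i).2 fun h' => hi h'.1⟩,
      fun i => ⟨fun _ => key i, fun hi => (h i).2 fun h' => hi h'.2⟩⟩

theorem isFaceOf_cone_basis {I J : Set (Fin n)} (hJ : J ⊆ I) :
    (cone (b '' J)).IsFaceOf (cone (b '' I)) where
  le := cone_le_iff.2 (by rintro _ ⟨i, hi, rfl⟩; exact toReal_mem_cone ⟨i, hJ hi, rfl⟩)
  mem_of_smul_add_mem := by
    intro x y a hx hy ha hxy
    rw [mem_cone_basis] at *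
    intro i
    have hx0 : 0 ≤ toReal (dualVec b i) ⬝ᵥ x := by
      by_cases hi : i ∈ I
      · exact (hx i).1 hi
      · exact ((hx i).2 hi).ge
    have hy0 : 0 ≤ toReal (dualVec b i) ⬝ᵥ y := by
      by_cases hi : i ∈ I
      · exact (hy i).1 hi
      · exact ((hy i).2 hi).ge
    refine ⟨fun _ => hx0, fun hi => ?_⟩
    have h := (hxy i).2 hi
    rw [dotProduct_add, dotProduct_smul, smul_eq_mul] at h
    nlinarith [mul_nonneg ha.le hx0]

/-- Every face of a smooth cone is spanned by a part of the basis that spans the cone. -/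
theorem exists_eq_cone_of_isFaceOf {I : Set (Fin n)} {τ : PointedCone ℝ (Fin n → ℝ)}
    (hτ : τ.IsFaceOf (cone (b '' I))) : ∃ J ⊆ I, τ = cone (b '' J) := by
  classical
  refine ⟨{i ∈ I | toReal (b i) ∈ τ}, fun i hi => hi.1, le_antisymm (fun x hx => ?_) ?_⟩
  · have hxI := (mem_cone_basis b).1 (hτ.le hx)
    refine (mem_cone_basis b).2 fun i => ⟨fun hi => (hxI i).1 hi.1, fun hi => ?_⟩
    by_cases hiI : i ∈ I
    · by_contra hne
      have hpos : 0 < toReal (dualVec b i) ⬝ᵥ x := lt_of_le_of_ne ((hxI i).1 hiI) (Ne.symm hne)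
      refine hi ⟨hiI, ?_⟩
      have hsum : ∑ k, (toReal (dualVec b k) ⬝ᵥ x) • (if k ∈ I then toReal (b k) else 0) = x := by
        conv_rhs => rw [eq_sum_toReal b x]
        refine Finset.sum_congr rfl fun k _ => ?_
        split_ifs with hk
        · rfl
        · rw [(hxI k).2 hk, zero_smul, zero_smul]
      have := hτ.mem_of_sum_smul_mem (f := fun k => if k ∈ I then toReal (b k) else 0)
        (c := fun k => toReal (dualVec b k) ⬝ᵥ x) (fun k => by
          split_ifs with hk
          · exact toReal_mem_cone ⟨k, hk, rfl⟩
          · exact Submodule.zero_mem _) (fun k => by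
          by_cases hk : k ∈ I
          · exact (hxI k).1 hk
          · exact ((hxI k).2 hk).ge) (by rw [hsum]; exact hx) i hpos
      simpa [hiI] using this
    · exact (hxI i).2 hiI
  · rw [cone_le_iff]
    rintro _ ⟨i, hi, rfl⟩
    exact hi.2

theorem eq_basis_of_mem_cone {v : Fin n → ℤ} (hv : IsPrimitive v) {i : Fin n}
    (h : toReal (b i) ∈ cone {v}) : v = b i := by
  obtain ⟨c, hc, hbi⟩ := mem_cone_singleton.1 h
  have key : ∀ k, ((if i = k then 1 else 0 : ℤ) : ℝ) = c * ((b.repr v k : ℤ) : ℝ) := by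
    intro k
    have := congrArg (toReal (dualVec b k) ⬝ᵥ ·) hbi
    simp only [dotProduct_smul, smul_eq_mul] at this
    rwa [toReal_dotProduct, toReal_dotProduct, dualVec_dotProduct_basis, dualVec_dotProduct,
      Module.Basis.coord_apply] at this
  have hi := key i
  rw [if_pos rfl, Int.cast_one] at hi
  have hc0 : c ≠ 0 := by rintro rfl; simp at hi
  have hv1 : v = b.repr v i • b i := by
    conv_lhs => rw [← b.sum_repr v]
    refine Finset.sum_eq_single i (fun k _ hk => ?_) (by simp)
    have := key k
    rw [if_neg hk.symm, Int.cast_zero, eq_comm, mul_eq_zero] at this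
    have h0 : b.repr v k = 0 := by exact_mod_cast this.resolve_left hc0
    rw [h0, zero_smul]
  have hunit := hv _ _ hv1
  have hpos : (0 : ℝ) < ((b.repr v i : ℤ) : ℝ) := by
    by_contra hneg
    have := mul_nonpos_of_nonneg_of_nonpos hc (not_lt.1 hneg)
    linarith
  have hpos' : 0 < b.repr v i := by exact_mod_cast hpos
  rcases Int.isUnit_iff.1 hunit with h1 | h1
  · rw [h1, one_smul] at hv1
    exact hv1
  · omega

theorem dim_cone_singleton {w : Fin n → ℤ} (hw : w ≠ 0) : dim (cone {w}) = 1 := by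
  have hw' : toReal w ≠ 0 := fun h => hw (funext fun i => by
    have := congrFun h i
    simpa [toReal] using this)
  have : Submodule.span ℝ ((cone {w} : PointedCone ℝ (Fin n → ℝ)) : Set (Fin n → ℝ)) =
      Submodule.span ℝ {toReal w} := by
    refine le_antisymm (Submodule.span_le.2 fun x hx => ?_)
      (Submodule.span_mono (Set.singleton_subset_iff.2 (toReal_mem_cone rfl)))
    obtain ⟨c, -, rfl⟩ := mem_cone_singleton.1 hx
    exact Submodule.smul_mem _ _ (Submodule.mem_span_singleton_self _)
  rw [dim, this, finrank_span_singleton hw']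

variable {d : ℕ} {Δ : Fan n} {v : Fin d → Fin n → ℤ} (hv : Δ.IsEdgeEnumeration v)
  {I : Set (Fin n)} (hI : cone (b '' I) ∈ Δ.cones)

include hv in
theorem Fan.IsEdgeEnumeration.cone_mem (j : Fin d) : cone {v j} ∈ Δ.cones :=
  ((hv.edges _).2 ⟨j, rfl⟩).1

include hv hI in
/-- The basis vectors that span a cone of the fan are edge vectors. -/
theorem Fan.IsEdgeEnumeration.exists_eq_basis {i : Fin n} (hi : i ∈ I) : ∃ j, v j = b i := by
  have h1 : cone {b i} ∈ Δ.cones := by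
    have := Δ.face_mem _ hI _ (isFaceOf_cone_basis b (Set.singleton_subset_iff.2 hi))
    rwa [Set.image_singleton] at this
  obtain ⟨j, hj⟩ := (hv.edges _).1 ⟨h1, dim_cone_singleton (b.ne_zero i)⟩
  exact ⟨j, eq_basis_of_mem_cone b (hv.primitive j) (hj ▸ toReal_mem_cone rfl)⟩

include hv hI in
/-- The edge vectors in a cone of the fan are among the basis vectors that span it. -/
theorem Fan.IsEdgeEnumeration.exists_basis_eq {j : Fin d} (hj : toReal (v j) ∈ cone (b '' I)) :
    ∃ i ∈ I, b i = v j := by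
  have hface := (Δ.inter_face _ (hv.cone_mem j) _ hI).2
  rw [inf_eq_left.2 (cone_le_iff.2 (by rintro _ rfl; exact hj))] at hface
  obtain ⟨J, hJ, hJ'⟩ := exists_eq_cone_of_isFaceOf b hface
  obtain ⟨i, hi⟩ : J.Nonempty := by
    by_contra hne
    rw [Set.not_nonempty_iff_eq_empty] at hne
    have h1 := ((hv.edges _).2 ⟨j, rfl⟩).2
    rw [hJ', hne, Set.image_empty] at h1
    have h2 : (cone ∅ : PointedCone ℝ (Fin n → ℝ)) = ⊥ := by simp [cone, PointedCone.hull]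
    rw [h2, dim, show ((⊥ : PointedCone ℝ (Fin n → ℝ)) : Set (Fin n → ℝ)) = {0} from rfl,
      Submodule.span_zero_singleton, finrank_bot] at h1
    exact absurd h1 zero_ne_one
  exact ⟨i, hJ hi, (eq_basis_of_mem_cone b (hv.primitive j)
    (hJ' ▸ toReal_mem_cone ⟨i, hi, rfl⟩)).symm⟩

include hv hI in
/-- Two edge vectors in a common cone of the fan span a cone of the fan. -/
theorem Fan.IsEdgeEnumeration.spansCone {i j : Fin d} (hi : toReal (v i) ∈ cone (b '' I))
    (hj : toReal (v j) ∈ cone (b '' I)) : Δ.SpansCone (v i) (v j) := by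
  obtain ⟨i', hi', hi⟩ := hv.exists_basis_eq b hI hi
  obtain ⟨j', hj', hj⟩ := hv.exists_basis_eq b hI hj
  have := Δ.face_mem _ hI _ (isFaceOf_cone_basis b (J := {i', j'})
    (by rintro k (rfl | rfl) <;> assumption))
  rwa [Set.image_pair, hi, hj] at this

end Cones

end RealToric

/-! ### Affine charts in coordinates -/

namespace RealToric

open Set Topology

namespace AffineChart

variable {n : ℕ} {σ τ : PointedCone ℝ (Fin n → ℝ)}

/-- The value of a point of `U_σ` at an element of the semigroup `S_σ`. -/
def eval (f : AffineChart σ) (u : dualSemigroup σ) : ℝ :=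
  DFunLike.coe (F := Multiplicative (dualSemigroup σ) →* ℝ) f (Multiplicative.ofAdd u)

/-- A point of `U_σ` from its values. -/
def mk (g : dualSemigroup σ → ℝ) (h0 : g 0 = 1) (hadd : ∀ u w, g (u + w) = g u * g w) :
    AffineChart σ :=
  { toFun := fun u => g u.toAdd
    map_one' := h0
    map_mul' := fun u w => hadd u.toAdd w.toAdd : Multiplicative (dualSemigroup σ) →* ℝ }

@[simp]
theorem eval_mk (g : dualSemigroup σ → ℝ) (h0 : g 0 = 1) (hadd : ∀ u w, g (u + w) = g u * g w)
    (u : dualSemigroup σ) : (mk g h0 hadd).eval u = g u := rfl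

theorem eval_zero (f : AffineChart σ) : f.eval 0 = 1 :=
  map_one (F := Multiplicative (dualSemigroup σ) →* ℝ) f

theorem eval_add (f : AffineChart σ) (u w : dualSemigroup σ) :
    f.eval (u + w) = f.eval u * f.eval w :=
  map_mul (F := Multiplicative (dualSemigroup σ) →* ℝ) f _ _

theorem eval_nsmul (f : AffineChart σ) (k : ℕ) (u : dualSemigroup σ) :
    f.eval (k • u) = f.eval u ^ k :=
  map_pow (F := Multiplicative (dualSemigroup σ) →* ℝ) f _ k

theorem eval_sum (f : AffineChart σ) {κ : Type*} (s : Finset κ) (u : κ → dualSemigroup σ) :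
    f.eval (∑ i ∈ s, u i) = ∏ i ∈ s, f.eval (u i) :=
  map_prod (G := Multiplicative (dualSemigroup σ) →* ℝ) f
    (fun i => Multiplicative.ofAdd (u i)) s

theorem ext_eval {f g : AffineChart σ} (h : ∀ u, f.eval u = g.eval u) : f = g :=
  DFunLike.ext (F := Multiplicative (dualSemigroup σ) →* ℝ) f g h

theorem continuous_eval (u : dualSemigroup σ) : Continuous fun f : AffineChart σ => f.eval u :=
  (continuous_apply (Multiplicative.ofAdd u)).comp continuous_induced_dom

theorem continuous_of_eval {Y : Type*} [TopologicalSpace Y] {g : Y → AffineChart σ}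
    (h : ∀ u, Continuous fun y => (g y).eval u) : Continuous g :=
  continuous_induced_rng.2 (continuous_pi fun u => h u.toAdd)

theorem continuous_incl (h : τ ≤ σ) : Continuous (incl h) :=
  continuous_of_eval fun _ => continuous_eval _

variable (b : Module.Basis (Fin n) ℤ (Fin n → ℤ)) (I : Set (Fin n))

theorem dualVec_mem (i : Fin n) : dualVec b i ∈ dualSemigroup (cone (b '' I)) :=
  mem_dualSemigroup_cone.2 (by
    rintro _ ⟨k, -, rfl⟩
    rw [dualVec_dotProduct_basis]
    split_ifs <;> simp)

theorem neg_dualVec_mem {i : Fin n} (hi : i ∉ I) :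
    -dualVec b i ∈ dualSemigroup (cone (b '' I)) :=
  mem_dualSemigroup_cone.2 (by
    rintro _ ⟨k, hk, rfl⟩
    rw [neg_dotProduct, dualVec_dotProduct_basis, if_neg (fun h : k = i => hi (h ▸ hk)), neg_zero])

/-- The coordinates of a point of a smooth affine chart: its values at the dual basis. -/
noncomputable def coord (f : AffineChart (cone (b '' I))) (i : Fin n) : ℝ :=
  f.eval ⟨dualVec b i, dualVec_mem b I i⟩

theorem coord_ne_zero (f : AffineChart (cone (b '' I))) {i : Fin n} (hi : i ∉ I) :
    coord b I f i ≠ 0 := by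
  intro h
  have h1 := f.eval_add ⟨dualVec b i, dualVec_mem b I i⟩ ⟨-dualVec b i, neg_dualVec_mem b I hi⟩
  rw [show (⟨dualVec b i, dualVec_mem b I i⟩ + ⟨-dualVec b i, neg_dualVec_mem b I hi⟩ :
    dualSemigroup (cone (b '' I))) = 0 from Subtype.ext (add_neg_cancel _), eval_zero] at h1
  rw [show f.eval ⟨dualVec b i, dualVec_mem b I i⟩ = 0 from h, zero_mul] at h1
  exact one_ne_zero h1

theorem continuous_coord : Continuous (coord b I) :=
  continuous_pi fun _ => continuous_eval _

/-- Points of a smooth affine chart are determined by their coordinates. -/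
theorem eval_eq_prod (f : AffineChart (cone (b '' I))) (u : dualSemigroup (cone (b '' I))) :
    f.eval u = ∏ i, coord b I f i ^ ((u : Fin n → ℤ) ⬝ᵥ b i) := by
  have hu : ∀ i ∈ I, 0 ≤ (u : Fin n → ℤ) ⬝ᵥ b i := fun i hi =>
    mem_dualSemigroup_cone.1 u.2 _ ⟨i, hi, rfl⟩
  have hterm : ∀ (i : Fin n) (m : ℤ), (i ∈ I → 0 ≤ m) →
      ∃ h : m • dualVec b i ∈ dualSemigroup (cone (b '' I)),
        f.eval ⟨m • dualVec b i, h⟩ = coord b I f i ^ m := by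
    intro i m hm
    have hnat : ∀ k : ℕ, ∃ h : (k : ℤ) • dualVec b i ∈ dualSemigroup (cone (b '' I)),
        f.eval ⟨(k : ℤ) • dualVec b i, h⟩ = coord b I f i ^ k := by
      intro k
      have h : (k : ℤ) • dualVec b i ∈ dualSemigroup (cone (b '' I)) := by
        rw [natCast_zsmul]
        exact AddSubmonoid.nsmul_mem _ (dualVec_mem b I i) k
      refine ⟨h, ?_⟩
      rw [coord, ← eval_nsmul]
      exact congrArg f.eval (Subtype.ext (natCast_zsmul _ _))
    by_cases h0 : 0 ≤ m
    · lift m to ℕ using h0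
      obtain ⟨h, h'⟩ := hnat m
      exact ⟨h, h'.trans (zpow_natCast _ _).symm⟩
    · have hi : i ∉ I := fun hi => h0 (hm hi)
      obtain ⟨k, rfl⟩ : ∃ k : ℕ, m = -(k : ℤ) := ⟨m.natAbs, by omega⟩
      have h : (-(k : ℤ)) • dualVec b i ∈ dualSemigroup (cone (b '' I)) := by
        rw [neg_smul, ← smul_neg, natCast_zsmul]
        exact AddSubmonoid.nsmul_mem _ (neg_dualVec_mem b I hi) k
      refine ⟨h, ?_⟩
      obtain ⟨h', h''⟩ := hnat k
      have hmul := f.eval_add ⟨_, h⟩ ⟨_, h'⟩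
      rw [show (⟨_, h⟩ + ⟨_, h'⟩ : dualSemigroup (cone (b '' I))) = 0 from
        Subtype.ext (by simp), eval_zero, h''] at hmul
      rw [zpow_neg, zpow_natCast]
      exact eq_inv_of_mul_eq_one_left hmul.symm
  choose hmem heval using fun i => hterm i ((u : Fin n → ℤ) ⬝ᵥ b i) (hu i)
  have husum : u = ∑ i, ⟨_, hmem i⟩ := Subtype.ext (by
    rw [AddSubmonoid.coe_finsetSum]
    exact eq_sum_dualVec b u)
  conv_lhs => rw [husum]
  rw [eval_sum]
  exact Finset.prod_congr rfl fun i _ => heval i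

theorem coord_injective : Function.Injective (coord b I) := fun f g h =>
  ext_eval fun u => by rw [eval_eq_prod, eval_eq_prod, h]

/-- The image of a smooth affine chart in coordinates. -/
def coordSet : Set (Fin n → ℝ) := {x | ∀ i, i ∉ I → x i ≠ 0}

theorem isOpen_coordSet : IsOpen (coordSet I) := by
  have : coordSet I = ⋂ i, {x | i ∉ I → x i ≠ 0} := by ext; simp [coordSet]
  rw [this]
  refine isOpen_iInter_of_finite fun i => ?_
  by_cases hi : i ∈ I
  · simp [hi]
  · simpa [hi] using isOpen_ne_fun (continuous_apply i) continuous_const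

/-- The point of a smooth affine chart with given coordinates. -/
noncomputable def ofCoord (x : coordSet I) : AffineChart (cone (b '' I)) :=
  mk (fun u => ∏ i, x.1 i ^ ((u : Fin n → ℤ) ⬝ᵥ b i)) (by simp) (by
    intro u w
    rw [← Finset.prod_mul_distrib]
    refine Finset.prod_congr rfl fun i _ => ?_
    rw [AddSubmonoid.coe_add, add_dotProduct]
    by_cases hi : i ∈ I
    · obtain ⟨k, hk⟩ := Int.eq_ofNat_of_zero_le
        (mem_dualSemigroup_cone.1 u.2 (b i) ⟨i, hi, rfl⟩)
      obtain ⟨l, hl⟩ := Int.eq_ofNat_of_zero_le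
        (mem_dualSemigroup_cone.1 w.2 (b i) ⟨i, hi, rfl⟩)
      rw [hk, hl, ← Nat.cast_add, zpow_natCast, zpow_natCast, zpow_natCast, pow_add]
    · exact zpow_add₀ (x.2 i hi) _ _)

theorem coord_ofCoord (x : coordSet I) : coord b I (ofCoord b I x) = x := by
  funext i
  rw [coord, ofCoord, eval_mk]
  simp only [dualVec_dotProduct_basis]
  rw [Finset.prod_eq_single i (fun k _ hk => by rw [if_neg hk, zpow_zero]) (by simp), if_pos rfl,
    zpow_one]

theorem continuous_ofCoord : Continuous (ofCoord b I) := by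
  refine continuous_of_eval fun u => ?_
  simp only [ofCoord, eval_mk]
  refine continuous_finsetProd _ fun i _ => ?_
  rw [continuous_iff_continuousAt]
  intro x
  refine ContinuousAt.zpow₀ ((continuous_apply i).comp continuous_subtype_val).continuousAt _ ?_
  by_cases hi : i ∈ I
  · exact Or.inr (mem_dualSemigroup_cone.1 u.2 (b i) ⟨i, hi, rfl⟩)
  · exact Or.inl (x.2 i hi)

/-- The coordinates identify a smooth affine chart with an open subset of `ℝⁿ`. -/
noncomputable def chartHomeo : AffineChart (cone (b '' I)) ≃ₜ coordSet I where
  toFun f := ⟨coord b I f, fun _ hi => coord_ne_zero b I f hi⟩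
  invFun := ofCoord b I
  left_inv _ := coord_injective b I (coord_ofCoord b I _)
  right_inv x := Subtype.ext (coord_ofCoord b I x)
  continuous_toFun := (continuous_coord b I).subtype_mk _
  continuous_invFun := continuous_ofCoord b I

variable {I} {J : Set (Fin n)}

theorem coord_incl (h : cone (b '' J) ≤ cone (b '' I)) (f : AffineChart (cone (b '' J))) :
    coord b I (incl h f) = coord b J f := rfl

theorem isOpenEmbedding_incl_basis (hJ : J ⊆ I) (h : cone (b '' J) ≤ cone (b '' I)) :
    IsOpenEmbedding (incl h) := by
  have hsub : coordSet J ⊆ coordSet I := fun x hx i hi => hx i fun hi' => hi (hJ hi')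
  have : incl h = (chartHomeo b I).symm ∘ Set.inclusion hsub ∘ chartHomeo b J := by
    funext f
    apply coord_injective b I
    exact (coord_ofCoord b I (Set.inclusion hsub (chartHomeo b J f))).symm
  rw [this]
  exact (chartHomeo b I).symm.isOpenEmbedding.comp
    ((IsOpenEmbedding.inclusion hsub ((isOpen_coordSet J).preimage continuous_subtype_val)).comp (chartHomeo b J).isOpenEmbedding)

theorem mem_range_incl_basis (h : cone (b '' J) ≤ cone (b '' I))
    (f : AffineChart (cone (b '' I))) :
    f ∈ range (incl h) ↔ coord b I f ∈ coordSet J := by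
  constructor
  · rintro ⟨g, rfl⟩ i hi
    exact coord_ne_zero b J g hi
  · intro hf
    exact ⟨ofCoord b J ⟨_, hf⟩, coord_injective b I (coord_ofCoord b J _)⟩

theorem coordSet_inter (I I' : Set (Fin n)) : coordSet I ∩ coordSet I' = coordSet (I ∩ I') := by
  ext x
  constructor
  · rintro ⟨h, h'⟩ i hi
    by_cases h1 : i ∈ I
    · exact h' i fun h2 => hi ⟨h1, h2⟩
    · exact h i h1
  · intro h
    exact ⟨fun i hi => h i fun h' => hi h'.1, fun i hi => h i fun h' => hi h'.2⟩

end AffineChart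

end RealToric

/-! ### The topology of the real toric variety -/

namespace RealToric

open Set Topology AffineChart

variable {n : ℕ} {Δ : Fan n}

theorem Fan.isOpenEmbedding_incl (hΔ : Δ.IsSmooth) {σ τ : PointedCone ℝ (Fin n → ℝ)}
    (hσ : σ ∈ Δ.cones) (hτ : τ.IsFaceOf σ) : IsOpenEmbedding (incl hτ.le) := by
  obtain ⟨b, I, rfl⟩ := hΔ σ hσ
  obtain ⟨J, hJ, rfl⟩ := exists_eq_cone_of_isFaceOf b hτ
  exact isOpenEmbedding_incl_basis b hJ hτ.le

/-- For two faces `τ` and `τ'` of `σ`, the open subsets `U_τ` and `U_τ'` of `U_σ` meet in the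
chart of `τ ⊓ τ'`. -/
theorem Fan.mem_range_incl_inf (hΔ : Δ.IsSmooth) {σ τ τ' : PointedCone ℝ (Fin n → ℝ)}
    (hσ : σ ∈ Δ.cones) (hτ : τ.IsFaceOf σ) (hτ' : τ'.IsFaceOf σ) {f : AffineChart σ}
    (hf : f ∈ range (incl hτ.le)) (hf' : f ∈ range (incl hτ'.le)) :
    f ∈ range (incl (hτ.inf_left hτ').le) := by
  obtain ⟨b, I, rfl⟩ := hΔ σ hσ
  obtain ⟨J, hJ, rfl⟩ := exists_eq_cone_of_isFaceOf b hτ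
  obtain ⟨J', hJ', rfl⟩ := exists_eq_cone_of_isFaceOf b hτ'
  rw [mem_range_incl_basis] at hf hf'
  have h : ∀ ρ : PointedCone ℝ (Fin n → ℝ), ρ = cone (b '' (J ∩ J')) →
      ∀ h : ρ ≤ cone (b '' I), f ∈ range (incl h) := by
    rintro _ rfl h
    rw [mem_range_incl_basis, ← coordSet_inter]
    exact ⟨hf, hf'⟩
  exact h _ (cone_basis_inf b J J') _

theorem Fan.inf_mem (Δ : Fan n) {σ τ : PointedCone ℝ (Fin n → ℝ)} (hσ : σ ∈ Δ.cones)
    (hτ : τ ∈ Δ.cones) : σ ⊓ τ ∈ Δ.cones :=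
  Δ.face_mem σ hσ _ (Δ.inter_face σ hσ τ hτ).1

theorem Fan.equivalence_glue (hΔ : Δ.IsSmooth) : Equivalence Δ.Glue where
  refl p := ⟨incl (le_inf le_rfl le_rfl) p.2, rfl, rfl⟩
  symm := by
    rintro p q ⟨z, hz, hz'⟩
    exact ⟨incl (le_of_eq (inf_comm _ _)) z, hz', hz⟩
  trans := by
    rintro ⟨σ, f⟩ ⟨τ, g⟩ ⟨ρ, h⟩ ⟨z, hz, hz'⟩ ⟨w, hw, hw'⟩
    dsimp only at *
    have h1 := (Δ.inter_face σ.1 σ.2 τ.1 τ.2).2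
    have h2 := (Δ.inter_face τ.1 τ.2 ρ.1 ρ.2).1
    obtain ⟨y, hy⟩ := Fan.mem_range_incl_inf hΔ τ.2 h1 h2 ⟨z, hz'⟩ ⟨w, hw⟩
    have hy1 : incl inf_le_left y = z := (Fan.isOpenEmbedding_incl hΔ τ.2 h1).injective
      (by rw [hz']; exact hy)
    have hy2 : incl inf_le_right y = w := (Fan.isOpenEmbedding_incl hΔ τ.2 h2).injective
      (by rw [hw]; exact hy)
    refine ⟨incl (le_inf (inf_le_left.trans inf_le_left) (inf_le_right.trans inf_le_right)) y,
      ?_, ?_⟩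
    · rw [← hz, ← hy1]; rfl
    · rw [← hw', ← hy2]; rfl

/-- The canonical map `U_σ → X`. -/
def Fan.toX (Δ : Fan n) (σ : Δ.cones) (f : AffineChart σ.1) : Δ.X := Quot.mk _ ⟨σ, f⟩

theorem Fan.toX_eq_iff (hΔ : Δ.IsSmooth) {σ τ : Δ.cones} {f : AffineChart σ.1}
    {g : AffineChart τ.1} : Δ.toX σ f = Δ.toX τ g ↔
      ∃ z : AffineChart (σ.1 ⊓ τ.1), incl inf_le_left z = f ∧ incl inf_le_right z = g :=
  (Fan.equivalence_glue hΔ).quot_mk_eq_iff _ _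

theorem Fan.toX_incl {σ τ : Δ.cones} (h : τ.1 ≤ σ.1) (f : AffineChart τ.1) :
    Δ.toX σ (incl h f) = Δ.toX τ f :=
  Quot.sound ⟨incl (le_inf h le_rfl) f, rfl, rfl⟩

theorem Fan.continuous_toX (σ : Δ.cones) : Continuous (Δ.toX σ) :=
  continuous_quot_mk.comp (continuous_sigmaMk (σ := fun σ : Δ.cones => AffineChart σ.1))

theorem Fan.isOpenEmbedding_toX (hΔ : Δ.IsSmooth) (σ : Δ.cones) :
    IsOpenEmbedding (Δ.toX σ) := by
  refine .of_continuous_injective_isOpenMap (Fan.continuous_toX σ) (fun f g h => ?_) ?_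
  · obtain ⟨z, hz, hz'⟩ := (Fan.toX_eq_iff hΔ).1 h
    exact hz.symm.trans hz'
  · intro V hV
    refine isOpen_coinduced.2 (isOpen_sigma_iff.2 fun τ => ?_)
    have : Sigma.mk τ ⁻¹' (Quot.mk Δ.Glue ⁻¹' (Δ.toX σ '' V)) =
        incl (inf_le_right : σ.1 ⊓ τ.1 ≤ τ.1) ''
          (incl (inf_le_left : σ.1 ⊓ τ.1 ≤ σ.1) ⁻¹' V) := by
      ext g
      constructor
      · rintro ⟨f, hf, hfg⟩
        obtain ⟨z, hz, hz'⟩ := (Fan.toX_eq_iff hΔ (τ := τ) (g := g)).1 hfg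
        refine ⟨z, ?_, hz'⟩
        rw [mem_preimage, hz]
        exact hf
      · rintro ⟨z, hz, rfl⟩
        exact ⟨_, hz, (Fan.toX_eq_iff hΔ (τ := τ)).2 ⟨z, rfl, rfl⟩⟩
    refine (congrArg IsOpen this).mpr ?_
    exact (Fan.isOpenEmbedding_incl hΔ τ.2 (Δ.inter_face σ.1 σ.2 τ.1 τ.2).2).isOpenMap _
      (hV.preimage (continuous_incl _))

theorem Fan.exists_toX (x : Δ.X) : ∃ σ f, Δ.toX σ f = x := by
  obtain ⟨⟨σ, f⟩, rfl⟩ := Quot.exists_rep x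
  exact ⟨σ, f, rfl⟩

theorem Fan.range_toX_inter (hΔ : Δ.IsSmooth) (σ τ : Δ.cones) :
    range (Δ.toX ⟨σ.1 ⊓ τ.1, Δ.inf_mem σ.2 τ.2⟩) = range (Δ.toX σ) ∩ range (Δ.toX τ) := by
  ext x
  constructor
  · rintro ⟨f, rfl⟩
    exact ⟨⟨incl inf_le_left f, Fan.toX_incl (τ := ⟨σ.1 ⊓ τ.1, _⟩) _ f⟩,
      ⟨incl inf_le_right f, Fan.toX_incl (τ := ⟨σ.1 ⊓ τ.1, _⟩) _ f⟩⟩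
  · rintro ⟨⟨f, rfl⟩, ⟨g, hg⟩⟩
    obtain ⟨z, hz, -⟩ := (Fan.toX_eq_iff hΔ).1 hg.symm
    exact ⟨z, by rw [← hz]; exact (Fan.toX_incl (τ := ⟨σ.1 ⊓ τ.1, _⟩) _ z).symm⟩

/-! ### Chambers -/

/-- The sign character of `ℤ/2`. -/
noncomputable def sgn (t : ZMod 2) : ℝ := if t = 0 then 1 else -1

theorem sgn_add (s t : ZMod 2) : sgn (s + t) = sgn s * sgn t := by
  have h : ∀ t : ZMod 2, t = 0 ∨ t = 1 := by decide
  rcases h s with rfl | rfl <;> rcases h t with rfl | rfl <;> simp [sgn, CharTwo.add_self_eq_zero]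

theorem sgn_eq (t : ZMod 2) : sgn t = 1 ∨ sgn t = -1 := by
  unfold sgn; split_ifs <;> simp

theorem sgn_injective : Function.Injective sgn := by
  have h : ∀ t : ZMod 2, t = 0 ∨ t = 1 := by decide
  intro s t hst
  rcases h s with rfl | rfl <;> rcases h t with rfl | rfl <;> simp_all [sgn] <;> norm_num at hst

theorem sgn_mul_self (t : ZMod 2) : sgn t * sgn t = 1 := by
  rcases sgn_eq t with h | h <;> simp [h]

theorem mod2_add (u w : Fin n → ℤ) : mod2 (u + w) = mod2 u + mod2 w := by
  ext; simp [mod2]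

theorem mod2_dotProduct (u w : Fin n → ℤ) : mod2 u ⬝ᵥ mod2 w = ((u ⬝ᵥ w : ℤ) : ZMod 2) := by
  simp [mod2, dotProduct]

theorem exists_mod2 (ε : Fin n → ZMod 2) : ∃ w, mod2 w = ε :=
  ⟨fun i => (ε i).val, by ext i; simp [mod2]⟩

/-- The element of the torus with signs `ε`, as a point of `U_σ`. -/
noncomputable def signPoint (σ : PointedCone ℝ (Fin n → ℝ)) (ε : Fin n → ZMod 2) :
    AffineChart σ :=
  AffineChart.mk (fun u => sgn (mod2 u ⬝ᵥ ε))
    (by rw [show mod2 ((0 : dualSemigroup σ) : Fin n → ℤ) = 0 from by ext; simp [mod2]]; simp [sgn])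
    (fun u w => by rw [AddSubmonoid.coe_add, mod2_add, add_dotProduct, sgn_add])

/-- A point of `U_σ` lies in the closed chamber with signs `ε` if its product with the element of
the torus with signs `ε` is nonnegative. -/
def AffineChart.InChamber {σ : PointedCone ℝ (Fin n → ℝ)} (ε : Fin n → ZMod 2)
    (f : AffineChart σ) : Prop :=
  ∀ u, 0 ≤ (signPoint σ ε).eval u * f.eval u

section Coordinates

variable (b : Module.Basis (Fin n) ℤ (Fin n → ℤ)) (I : Set (Fin n))

theorem coord_signPoint (ε : Fin n → ZMod 2) (i : Fin n) :
    coord b I (signPoint _ ε) i = sgn (mod2 (dualVec b i) ⬝ᵥ ε) := rfl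

theorem inChamber_iff_coord (ε : Fin n → ZMod 2) (f : AffineChart (cone (b '' I))) :
    f.InChamber ε ↔ ∀ i, 0 ≤ sgn (mod2 (dualVec b i) ⬝ᵥ ε) * coord b I f i := by
  constructor
  · intro h i
    exact h ⟨dualVec b i, dualVec_mem b I i⟩
  · intro h u
    rw [eval_eq_prod, eval_eq_prod, ← Finset.prod_mul_distrib]
    refine Finset.prod_nonneg fun i _ => ?_
    rw [← mul_zpow]
    exact zpow_nonneg (h i) _

theorem inChamber_incl_iff_basis {J : Set (Fin n)} (h : cone (b '' J) ≤ cone (b '' I))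
    (ε : Fin n → ZMod 2) (f : AffineChart (cone (b '' J))) :
    (incl h f).InChamber ε ↔ f.InChamber ε := by
  rw [inChamber_iff_coord, inChamber_iff_coord, coord_incl]

theorem exists_inChamber (f : AffineChart (cone (b '' I))) : ∃ ε, f.InChamber ε := by
  classical
  refine ⟨mod2 (∑ k, (if coord b I f k < 0 then (1 : ℤ) else 0) • b k), ?_⟩
  rw [inChamber_iff_coord]
  intro i
  have h : dualVec b i ⬝ᵥ (∑ k, (if coord b I f k < 0 then (1 : ℤ) else 0) • b k) =
      if coord b I f i < 0 then 1 else 0 := by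
    rw [dotProduct_sum]
    simp only [dotProduct_smul, dualVec_dotProduct_basis]
    simp
  rw [mod2_dotProduct, h]
  split_ifs with hi
  · simp [sgn, hi.le]
  · simpa [sgn] using hi

/-- The expansion of a vector modulo 2 with respect to the reduction of a lattice basis. -/
theorem eq_sum_mod2 (ε : Fin n → ZMod 2) :
    ε = ∑ i, (mod2 (dualVec b i) ⬝ᵥ ε) • mod2 (b i) := by
  obtain ⟨w, rfl⟩ := exists_mod2 ε
  conv_lhs => rw [← b.sum_repr w]
  funext l
  simp [mod2, mod2_dotProduct, dualVec_dotProduct]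

end Coordinates

theorem Fan.inChamber_incl_iff (hΔ : Δ.IsSmooth) {σ τ : PointedCone ℝ (Fin n → ℝ)}
    (hσ : σ ∈ Δ.cones) (hτ : τ.IsFaceOf σ) (ε : Fin n → ZMod 2) (f : AffineChart τ) :
    (incl hτ.le f).InChamber ε ↔ f.InChamber ε := by
  obtain ⟨b, I, rfl⟩ := hΔ σ hσ
  obtain ⟨J, hJ, rfl⟩ := exists_eq_cone_of_isFaceOf b hτ
  exact inChamber_incl_iff_basis b I _ ε f

/-- The closed chamber of the real toric variety with signs `ε`. -/
def Fan.InChamber (Δ : Fan n) (ε : Fin n → ZMod 2) (x : Δ.X) : Prop :=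
  ∃ σ f, Δ.toX σ f = x ∧ f.InChamber ε

theorem Fan.inChamber_toX (hΔ : Δ.IsSmooth) (ε : Fin n → ZMod 2) {σ : Δ.cones}
    (f : AffineChart σ.1) : Δ.InChamber ε (Δ.toX σ f) ↔ f.InChamber ε := by
  constructor
  · rintro ⟨τ, g, hg, hgε⟩
    obtain ⟨z, rfl, rfl⟩ := (Fan.toX_eq_iff hΔ).1 hg
    have h := Δ.inter_face τ.1 τ.2 σ.1 σ.2
    exact (Fan.inChamber_incl_iff hΔ σ.2 h.2 ε z).2
      ((Fan.inChamber_incl_iff hΔ τ.2 h.1 ε z).1 hgε)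
  · intro h
    exact ⟨σ, f, rfl, h⟩

/-- The element of the torus with signs `ε`, as a point of the real toric variety. -/
noncomputable def Fan.pt (Δ : Fan n) (ε : Fin n → ZMod 2) : Δ.X :=
  Δ.toX ⟨Δ.nonempty.some, Δ.nonempty.some_mem⟩ (signPoint _ ε)

theorem Fan.toX_signPoint (σ : Δ.cones) (ε : Fin n → ZMod 2) :
    Δ.toX σ (signPoint _ ε) = Δ.pt ε :=
  Quot.sound ⟨signPoint _ ε, rfl, rfl⟩

/-! ### Paths in the charts -/

section Paths

variable (b : Module.Basis (Fin n) ℤ (Fin n → ℤ)) {I : Set (Fin n)}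
  (hI : cone (b '' I) ∈ Δ.cones)

/-- The segment in coordinates connects points of a chart if the coordinates that do not vanish
anywhere on the chart have the same signs. -/
theorem Fan.joinedIn_toX {f g : AffineChart (cone (b '' I))}
    (h : ∀ i, i ∉ I → 0 < coord b I f i * coord b I g i) :
    JoinedIn (range (Δ.toX ⟨_, hI⟩)) (Δ.toX ⟨_, hI⟩ f) (Δ.toX ⟨_, hI⟩ g) := by
  have hmem : ∀ t : unitInterval, (1 - (t : ℝ)) • coord b I f + (t : ℝ) • coord b I g ∈ coordSet I := by
    intro t i hi h0
    have ht0 := t.2.1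
    have ht1 := t.2.2
    simp only [Pi.add_apply, Pi.smul_apply, smul_eq_mul] at h0
    have hpos := h i hi
    have hf : 0 < coord b I f i * coord b I f i := by
      exact mul_self_pos.2 (left_ne_zero_of_mul hpos.ne')
    have h1 : (1 - (t : ℝ)) * (coord b I f i * coord b I f i) +
        t * (coord b I f i * coord b I g i) = 0 := by
      linear_combination (coord b I f i) * h0
    rcases ht0.eq_or_lt with ht | ht
    · rw [← ht] at h1; linarith
    · have := mul_pos ht hpos
      have := mul_nonneg (sub_nonneg.2 ht1) hf.le
      linarith
  refine ⟨⟨⟨fun t => Δ.toX ⟨_, hI⟩ (ofCoord b I ⟨_, hmem t⟩), ?_⟩, ?_, ?_⟩, fun t => ⟨_, rfl⟩⟩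
  · refine (Fan.continuous_toX _).comp ((continuous_ofCoord b I).comp
      (Continuous.subtype_mk ?_ _))
    fun_prop
  · refine congrArg (Δ.toX ⟨_, hI⟩) (coord_injective b I ?_)
    rw [coord_ofCoord]
    simp
  · refine congrArg (Δ.toX ⟨_, hI⟩) (coord_injective b I ?_)
    rw [coord_ofCoord]
    simp

/-- A path in a smooth chart lifts to coordinates, where the signs of the coordinates that do not
vanish anywhere on the chart are constant. -/
theorem Fan.exists_lift_path (hΔ : Δ.IsSmooth) {f : AffineChart (cone (b '' I))} {y : Δ.X}
    (β : Path (Δ.toX ⟨_, hI⟩ f) y) (hβ : range β ⊆ range (Δ.toX ⟨_, hI⟩)) :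
    ∃ γ : C(unitInterval, Fin n → ℝ), (∀ t i, i ∉ I → 0 < coord b I f i * γ t i) ∧
      γ 0 = coord b I f ∧ ∀ t, ∃ g, γ t = coord b I g ∧ Δ.toX ⟨_, hI⟩ g = β t := by
  have he := (Fan.isOpenEmbedding_toX hΔ ⟨_, hI⟩).isEmbedding
  let g : unitInterval → AffineChart (cone (b '' I)) := fun t =>
    he.toHomeomorph.symm ⟨β t, hβ (mem_range_self t)⟩
  have hg : ∀ t, Δ.toX ⟨_, hI⟩ (g t) = β t := fun t =>
    congrArg Subtype.val (he.toHomeomorph.apply_symm_apply ⟨β t, hβ (mem_range_self t)⟩)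
  have hgc : Continuous g := he.toHomeomorph.symm.continuous.comp
    (β.continuous.subtype_mk _)
  have hg0 : g 0 = f := he.injective ((hg 0).trans β.source)
  refine ⟨⟨fun t => coord b I (g t), (continuous_coord b I).comp hgc⟩, fun t i hi => ?_,
    congrArg (coord b I) hg0, fun t => ⟨g t, rfl, hg t⟩⟩
  have hcont : Continuous fun t => coord b I f i * coord b I (g t) i :=
    continuous_const.mul ((continuous_apply i).comp ((continuous_coord b I).comp hgc))
  by_contra hneg
  have hsub := intermediate_value_univ t 0 hcont
  have hf := coord_ne_zero b I f hi
  have hpos : 0 ≤ coord b I f i * coord b I (g 0) i := by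
    rw [hg0]; exact mul_self_nonneg _
  obtain ⟨s, hs⟩ := hsub ⟨not_lt.1 hneg, hpos⟩
  exact (mul_ne_zero hf (coord_ne_zero b I (g s) hi)) hs

/-- The components of a smooth chart are convex in coordinates, so paths in a chart with the same
endpoints are homotopic. -/
theorem Fan.homotopic_of_range_subset (hΔ : Δ.IsSmooth) {x y : Δ.X} (β β' : Path x y)
    (hβ : range β ⊆ range (Δ.toX ⟨_, hI⟩)) (hβ' : range β' ⊆ range (Δ.toX ⟨_, hI⟩)) :
    β.Homotopic β' := by
  obtain ⟨f, rfl⟩ := hβ β.source_mem_range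
  let D : Set (Fin n → ℝ) := {p | ∀ i, i ∉ I → 0 < coord b I f i * p i}
  have hD : ∀ p ∈ D, p ∈ coordSet I := fun p hp i hi => right_ne_zero_of_mul (hp i hi).ne'
  have hconv : Convex ℝ D := by
    intro p hp q hq s t hs ht hst i hi
    have h1 := hp i hi
    have h2 := hq i hi
    simp only [Pi.add_apply, Pi.smul_apply, smul_eq_mul]
    have : coord b I f i * (s * p i + t * q i) =
        s * (coord b I f i * p i) + t * (coord b I f i * q i) := by ring
    rw [this]
    rcases hs.eq_or_lt with rfl | hs'
    · have : t = 1 := by linarith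
      subst this; simpa using h2
    · have := mul_pos hs' h1
      have := mul_nonneg ht h2.le
      linarith
  obtain ⟨γ, hγ, hγ0, hγβ⟩ := Fan.exists_lift_path b hI hΔ β hβ
  obtain ⟨γ', hγ', hγ0', hγβ'⟩ := Fan.exists_lift_path b hI hΔ β' hβ'
  have hne : D.Nonempty := ⟨γ 0, hγ 0⟩
  have : ContractibleSpace D := hconv.contractibleSpace hne
  let φ : D → Δ.X := fun p => Δ.toX ⟨_, hI⟩ (ofCoord b I ⟨p.1, hD p.1 p.2⟩)
  have hφ : Continuous φ := (Fan.continuous_toX _).comp ((continuous_ofCoord b I).comp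
    (continuous_subtype_val.subtype_mk _))
  have hlift : ∀ (p : D) (g : AffineChart (cone (b '' I))), p.1 = coord b I g →
      φ p = Δ.toX ⟨_, hI⟩ g := fun p g h => by
    refine congrArg (Δ.toX ⟨_, hI⟩) (coord_injective b I ?_)
    rw [coord_ofCoord]
    exact h
  have h1 : γ 1 = γ' 1 := by
    obtain ⟨g, hg, hgβ⟩ := hγβ 1
    obtain ⟨g', hg', hgβ'⟩ := hγβ' 1
    rw [hg, hg', (Fan.isOpenEmbedding_toX hΔ ⟨_, hI⟩).injective
      (hgβ.trans (β.target.trans (β'.target.symm.trans hgβ'.symm)))]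
  let Γ : Path (⟨γ 0, hγ 0⟩ : D) ⟨γ 1, hγ 1⟩ :=
    ⟨⟨fun t => ⟨γ t, hγ t⟩, γ.continuous.subtype_mk _⟩, rfl, rfl⟩
  let Γ' : Path (⟨γ 0, hγ 0⟩ : D) ⟨γ 1, hγ 1⟩ :=
    ⟨⟨fun t => ⟨γ' t, hγ' t⟩, γ'.continuous.subtype_mk _⟩, Subtype.ext (hγ0'.trans hγ0.symm),
      Subtype.ext h1.symm⟩
  have hΓ : (Γ.map hφ).Homotopic (Γ'.map hφ) :=
    (SimplyConnectedSpace.paths_homotopic Γ Γ').map ⟨φ, hφ⟩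
  have hs : Δ.toX ⟨_, hI⟩ f = φ ⟨γ 0, hγ 0⟩ := (hlift _ f hγ0).symm
  have ht : y = φ ⟨γ 1, hγ 1⟩ := by
    obtain ⟨g, hg, hgβ⟩ := hγβ 1
    rw [hlift _ g hg, hgβ, β.target]
  have e1 : β = (Γ.map hφ).cast hs ht := by
    ext t
    obtain ⟨g, hg, hgβ⟩ := hγβ t
    exact hgβ.symm.trans (hlift ⟨γ t, hγ t⟩ g hg).symm
  have e2 : β' = (Γ'.map hφ).cast hs ht := by
    ext t
    obtain ⟨g, hg, hgβ⟩ := hγβ' t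
    exact hgβ.symm.trans (hlift ⟨γ' t, hγ' t⟩ g hg).symm
  rw [e1, e2]
  exact hΓ.pathCast hs ht

variable {d : ℕ} {v : Fin d → Fin n → ℤ} (hv : Δ.IsEdgeEnumeration v)

include hv hI in
/-- Points in the same connected component of a chart lie in chambers whose labels differ by the
edge vectors of its cone. -/
theorem Fan.IsEdgeEnumeration.sub_mem_closure {f g : AffineChart (cone (b '' I))}
    (h : ∀ i, i ∉ I → 0 < coord b I f i * coord b I g i) {ε ε' : Fin n → ZMod 2}
    (hf : f.InChamber ε) (hg : g.InChamber ε') :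
    ε' - ε ∈ AddSubgroup.closure
      ((fun j => mod2 (v j)) '' {j | toReal (v j) ∈ cone (b '' I)}) := by
  rw [inChamber_iff_coord] at hf hg
  rw [eq_sum_mod2 b (ε' - ε)]
  refine AddSubgroup.sum_mem _ fun i _ => ?_
  by_cases hi : i ∈ I
  · obtain ⟨j, hj⟩ := hv.exists_eq_basis b hI hi
    have hmem : mod2 (b i) ∈ AddSubgroup.closure
        ((fun j => mod2 (v j)) '' {j | toReal (v j) ∈ cone (b '' I)}) :=
      AddSubgroup.subset_closure ⟨j, by
        rw [mem_ofPred_eq, hj]; exact toReal_mem_cone ⟨i, hi, rfl⟩, congrArg mod2 hj⟩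
    have hc : ∀ c : ZMod 2, c = 0 ∨ c = 1 := by decide
    rcases hc (mod2 (dualVec b i) ⬝ᵥ (ε' - ε)) with h0 | h0 <;> rw [h0]
    · rw [zero_smul]; exact zero_mem _
    · rwa [one_smul]
  · have h0 : mod2 (dualVec b i) ⬝ᵥ ε' = mod2 (dualVec b i) ⬝ᵥ ε := by
      refine sgn_injective ?_
      have h1 := hf i
      have h2 := hg i
      have h3 := h i hi
      have h4 := mul_nonneg h1 h2
      rcases sgn_eq (mod2 (dualVec b i) ⬝ᵥ ε) with e | e <;>
        rcases sgn_eq (mod2 (dualVec b i) ⬝ᵥ ε') with e' | e' <;>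
        rw [e, e'] at h4 ⊢ <;> nlinarith
    rw [dotProduct_sub, h0, sub_self, zero_smul]
    exact zero_mem _

end Paths

/-! ### The chamber atlas of the real toric variety -/

/-- A real toric variety is covered by its affine charts; its walls are the divisors of the edge
vectors, and its chambers are the translates of the nonnegative part by elements of order two of
the torus. -/
noncomputable def Fan.chamberAtlas (hΔ : Δ.IsSmooth) {d : ℕ} {v : Fin d → Fin n → ℤ}
    (hv : Δ.IsEdgeEnumeration v) : ChamberAtlas Δ.X Δ.cones (fun j => mod2 (v j))
      (fun i j => Δ.SpansCone (v i) (v j)) where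
  O σ := range (Δ.toX σ)
  J σ := {j | toReal (v j) ∈ σ.1}
  pt := Δ.pt
  InChamber := Δ.InChamber
  chartOf j := ⟨cone {v j}, hv.cone_mem j⟩
  isOpen_chart σ := (Fan.isOpenEmbedding_toX hΔ σ).isOpen_range
  exists_mem x := by
    obtain ⟨σ, f, rfl⟩ := Fan.exists_toX x
    exact ⟨σ, mem_range_self f⟩
  exists_inter σ τ := ⟨⟨σ.1 ⊓ τ.1, Δ.inf_mem σ.2 τ.2⟩, Fan.range_toX_inter hΔ σ τ, rfl⟩
  wall_add_wall j := funext fun i => CharTwo.add_self_eq_zero _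
  pt_mem σ ε := ⟨_, Fan.toX_signPoint σ ε⟩
  inChamber_pt ε ε' := by
    obtain ⟨b, I, h⟩ := hΔ _ Δ.nonempty.some_mem
    have key : ∀ (σ : PointedCone ℝ (Fin n → ℝ)), σ = cone (b '' I) →
        ((signPoint σ ε).InChamber ε' ↔ ε' = ε) := by
      rintro _ rfl
      rw [inChamber_iff_coord]
      simp only [coord_signPoint]
      constructor
      · intro h
        rw [eq_sum_mod2 b ε', eq_sum_mod2 b ε]
        refine Finset.sum_congr rfl fun i _ => ?_
        congr 1
        refine sgn_injective ?_
        have h1 := h i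
        rcases sgn_eq (mod2 (dualVec b i) ⬝ᵥ ε) with e | e <;>
          rcases sgn_eq (mod2 (dualVec b i) ⬝ᵥ ε') with e' | e' <;>
          rw [e, e'] at h1 ⊢ <;> norm_num at h1
      · rintro rfl i
        rw [sgn_mul_self]
        exact zero_le_one
    rw [Fan.pt, Fan.inChamber_toX hΔ]
    exact key _ h
  exists_inChamber x := by
    obtain ⟨⟨σ, hσ⟩, f, rfl⟩ := Fan.exists_toX x
    obtain ⟨b, I, rfl⟩ := hΔ σ hσ
    obtain ⟨ε, hε⟩ := exists_inChamber b I f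
    exact ⟨ε, ⟨_, hσ⟩, f, rfl, hε⟩
  joined := by
    rintro ⟨σ, hσ⟩ _ ε ⟨f, rfl⟩ hf
    rw [Fan.inChamber_toX hΔ] at hf
    obtain ⟨b, I, rfl⟩ := hΔ σ hσ
    rw [← Fan.toX_signPoint ⟨_, hσ⟩]
    refine Fan.joinedIn_toX b hσ fun i hi => ?_
    rw [inChamber_iff_coord] at hf
    refine lt_of_le_of_ne (hf i) (Ne.symm (mul_ne_zero ?_ (coord_ne_zero b I f hi)))
    exact coord_ne_zero b I (signPoint _ ε) hi
  joined_wall := by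
    rintro ⟨σ, hσ⟩ j ε hj
    obtain ⟨b, I, rfl⟩ := hΔ σ hσ
    rw [← Fan.toX_signPoint ⟨_, hσ⟩, ← Fan.toX_signPoint ⟨_, hσ⟩]
    refine Fan.joinedIn_toX b hσ fun i hi => ?_
    obtain ⟨k, hk, hkj⟩ := hv.exists_basis_eq b hσ hj
    rw [coord_signPoint, coord_signPoint, dotProduct_add, mod2_dotProduct, ← hkj,
      dualVec_dotProduct_basis, if_neg (fun h : k = i => hi (h ▸ hk)), Int.cast_zero, add_zero,
      sgn_mul_self]
    exact zero_lt_one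
  homotopic := by
    rintro ⟨σ, hσ⟩ x y β β' hβ hβ'
    obtain ⟨b, I, rfl⟩ := hΔ σ hσ
    exact Fan.homotopic_of_range_subset b hσ hΔ β β' hβ hβ'
  eventually_sub_mem := by
    rintro ⟨σ, hσ⟩ _ ⟨f, rfl⟩
    obtain ⟨b, I, rfl⟩ := hΔ σ hσ
    have hopen : IsOpen {g : AffineChart (cone (b '' I)) |
        ∀ i, i ∉ I → 0 < coord b I f i * coord b I g i} := by
      have : {g : AffineChart (cone (b '' I)) |
          ∀ i, i ∉ I → 0 < coord b I f i * coord b I g i} =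
          ⋂ i, {g | i ∉ I → 0 < coord b I f i * coord b I g i} := by ext; simp
      rw [this]
      refine isOpen_iInter_of_finite fun i => ?_
      by_cases hi : i ∈ I
      · simp [hi]
      · simpa [hi] using isOpen_lt continuous_const
          (continuous_const.mul ((continuous_apply i).comp (continuous_coord b I)))
    have hmem : Δ.toX ⟨_, hσ⟩ f ∈ Δ.toX ⟨_, hσ⟩ '' {g : AffineChart (cone (b '' I)) |
        ∀ i, i ∉ I → 0 < coord b I f i * coord b I g i} :=
      ⟨f, fun i hi => by
        exact mul_self_pos.2 (coord_ne_zero b I f hi), rfl⟩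
    filter_upwards [((Fan.isOpenEmbedding_toX hΔ ⟨_, hσ⟩).isOpenMap _ hopen).mem_nhds hmem]
    rintro _ ⟨g, hg, rfl⟩ ε ε' hε hε'
    rw [Fan.inChamber_toX hΔ] at hε hε'
    exact hv.sub_mem_closure b hσ hg hε hε'
  exists_coord := by
    rintro ⟨σ, hσ⟩
    obtain ⟨b, I, rfl⟩ := hΔ σ hσ
    choose i hi hiv using fun j : {j // toReal (v j) ∈ cone (b '' I)} =>
      hv.exists_basis_eq b hσ j.2
    refine ⟨⟨⟨fun ε j => mod2 (dualVec b (i j)) ⬝ᵥ ε, ?_⟩, ?_⟩, fun j k => ⟨fun h => ?_,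
      fun h => ?_⟩⟩
    · funext j; exact dotProduct_zero _
    · intro ε ε'; funext j; exact dotProduct_add (mod2 (dualVec b (i j))) ε ε'
    · subst h
      change mod2 (dualVec b (i k)) ⬝ᵥ mod2 (v k.1) = 1
      rw [mod2_dotProduct, ← hiv k, dualVec_dotProduct_basis, if_pos rfl, Int.cast_one]
    · change mod2 (dualVec b (i k)) ⬝ᵥ mod2 (v j.1) = 0
      rw [mod2_dotProduct, ← hiv j, dualVec_dotProduct_basis, if_neg, Int.cast_zero]
      intro hij
      refine h (Subtype.ext (hv.injective ?_))
      rw [← hiv j, ← hiv k, hij]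
  mem_chartOf j := toReal_mem_cone rfl
  chartOf_subset := by
    rintro σ j hj _ ⟨f, rfl⟩
    exact ⟨_, Fan.toX_incl (σ := σ) (τ := ⟨cone {v j}, hv.cone_mem j⟩)
      (cone_le_iff.2 (by rintro _ rfl; exact hj)) f⟩
  rel_of_mem := by
    rintro ⟨σ, hσ⟩ i j hi hj
    obtain ⟨b, I, rfl⟩ := hΔ σ hσ
    exact hv.spansCone b hσ hi hj
  exists_mem_of_rel i j hij :=
    ⟨⟨_, hij⟩, toReal_mem_cone (by simp), toReal_mem_cone (by simp)⟩

end RealToric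

/-! ### The fundamental group of a real toric variety -/

namespace RealToric

theorem not_mem_range_castLE {n d : ℕ} (hnd : n ≤ d) (j : Fin d) :
    j ∉ Set.range (Fin.castLE hnd) ↔ n ≤ (j : ℕ) := by
  rw [← not_lt, not_iff_not]
  exact ⟨fun ⟨p, hp⟩ => hp ▸ p.2, fun h => ⟨⟨j, h⟩, rfl⟩⟩

theorem oddPartners_iff {n d : ℕ} (Δ : Fan n) (v : Fin d → Fin n → ℤ) (hnd : n ≤ d)
    (b : Module.Basis (Fin n) (ZMod 2) (Fin n → ZMod 2)) :
    Coxeter.OddPartners b (fun i j => Δ.SpansCone (v i) (v j)) (fun j => mod2 (v j))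
      (Fin.castLE hnd) ↔ OddPartnerCondition Δ v hnd b := by
  simp only [Coxeter.OddPartners, OddPartnerCondition, not_mem_range_castLE]

/-- The indices of the edge vectors that do not belong to the basis. -/
def complEquiv {n d : ℕ} (hnd : n ≤ d) :
    {k : Fin d // k ∉ Set.range (Fin.castLE hnd)} ≃ Fin (d - n) where
  toFun k := ⟨k.1 - n, by
    have := (not_mem_range_castLE hnd k.1).1 k.2
    have := k.1.2
    omega⟩
  invFun k := ⟨⟨k + n, by omega⟩, (not_mem_range_castLE hnd _).2 (by simp)⟩
  left_inv k := by
    have := (not_mem_range_castLE hnd k.1).1 k.2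
    ext
    simp only
    omega
  right_inv k := by simp

/-- The fundamental group of a connected smooth real toric variety is the kernel of the
homomorphism from a right-angled Coxeter group that reduces the edge vectors modulo 2. -/
theorem Fan.exists_fundamentalGroup_equiv {n d : ℕ} {Δ : Fan n} (hΔ : Δ.IsSmooth)
    {v : Fin d → Fin n → ℤ} (hv : Δ.IsEdgeEnumeration v)
    (hgen : AddSubgroup.closure (Set.range fun j => mod2 (v j)) = ⊤) (x₀ : Δ.X) :
    Nonempty (FundamentalGroup Δ.X x₀ ≃* (Fan.chamberAtlas hΔ hv).wallHom.ker) := by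
  obtain ⟨Φ, hinj, hrange⟩ := (Fan.chamberAtlas hΔ hv).exists_fundamentalGroup_hom
  obtain ⟨p⟩ := (Fan.chamberAtlas hΔ hv).joined_pt_zero hgen x₀
  exact ⟨(FundamentalGroup.fundamentalGroupMulEquivOfPath p.symm).trans
    ((MonoidHom.ofInjective hinj).trans (MulEquiv.subgroupCongr hrange))⟩

end RealToric

theorem theorem5p1 (n d : ℕ) (Δ : RealToric.Fan n) (hsmooth : Δ.IsSmooth)
    (hconn : ConnectedSpace Δ.X)
    (v : Fin d → Fin n → ℤ) (hv : Δ.IsEdgeEnumeration v)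
    (hnd : n ≤ d) (b : Module.Basis (Fin n) (ZMod 2) (Fin n → ZMod 2))
    (hb : ∀ p : Fin n, b p = RealToric.mod2 (v (Fin.castLE hnd p)))
    (hcone : ∀ p q : Fin n, Δ.SpansCone (v (Fin.castLE hnd p)) (v (Fin.castLE hnd q)))
    (x₀ : Δ.X) :
    ((∀ α β : FundamentalGroup Δ.X x₀, α * β = β * α) ↔
      RealToric.AllPairsSpan Δ v ∨ RealToric.OddPartnerCondition Δ v hnd b) ∧
    (RealToric.AllPairsSpan Δ v →
      Nonempty (FundamentalGroup Δ.X x₀ ≃* Multiplicative (Fin (d - n) → ZMod 2))) := by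
  have hgen : AddSubgroup.closure (Set.range fun j => RealToric.mod2 (v j)) = ⊤ := by
    rw [eq_top_iff]
    intro x _
    have hx : x ∈ Submodule.span (ZMod 2) (Set.range b) := by rw [b.span_eq]; trivial
    induction hx using Submodule.span_induction with
    | mem y hy =>
      obtain ⟨p, rfl⟩ := hy
      exact AddSubgroup.subset_closure ⟨Fin.castLE hnd p, (hb p).symm⟩
    | zero => exact zero_mem _
    | add y z _ _ hy hz => exact add_mem (hy trivial) (hz trivial)
    | smul c y _ hy =>
      have hc : ∀ c : ZMod 2, c = 0 ∨ c = 1 := by decide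
      rcases hc c with rfl | rfl
      · rw [zero_smul]; exact zero_mem _
      · rw [one_smul]; exact hy trivial
  obtain ⟨e⟩ := RealToric.Fan.exists_fundamentalGroup_equiv hsmooth hv hgen x₀
  have hsymm : ∀ i j, Δ.SpansCone (v i) (v j) → Δ.SpansCone (v j) (v i) := fun i j h => by
    rwa [RealToric.Fan.SpansCone, Set.pair_comm]
  have hrefl : ∀ i, Δ.SpansCone (v i) (v i) := fun i => by
    rw [RealToric.Fan.SpansCone, Set.pair_eq_singleton]
    exact hv.cone_mem i
  have hπ := (RealToric.Fan.chamberAtlas hsmooth hv).wallHom_gen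
  constructor
  · have h := RealToric.Coxeter.comm_ker_iff b hπ hb hcone hsymm hrefl
    rw [RealToric.oddPartners_iff] at h
    refine Iff.trans ⟨fun hab x hx y hy => ?_, fun hab α β => ?_⟩ h
    · have := congrArg e (hab (e.symm ⟨x, hx⟩) (e.symm ⟨y, hy⟩))
      rw [map_mul, map_mul, e.apply_symm_apply, e.apply_symm_apply] at this
      exact congrArg Subtype.val this
    · apply e.injective
      rw [map_mul, map_mul]
      exact Subtype.ext (hab _ (e α).2 _ (e β).2)
  · intro hall
    obtain ⟨f⟩ := RealToric.Coxeter.ker_equiv b hπ hb hall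
    exact ⟨e.trans (f.trans (AddEquiv.toMultiplicative
      (AddEquiv.arrowCongr (RealToric.complEquiv hnd) (AddEquiv.refl (ZMod 2)))))⟩
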